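/- Consider a chemical reaction network with species $\ell=1,\dots,N$ and reversible reactions $j=1,\dots,M$, with stoichiometric coefficients $\nu^\pm_{j\ell}\in\mathbb N$, rate constants $k_j^\pm\ge 0$, and reaction vectors $\nu_j=\nu_j^--\nu_j^+\in\mathbb Z^N$. Assume conservation of mass: there is $m\in\mathbb R^N$ with all $m_\ell>0$ and $\nu_j\cdot m=0$ for all $j$. Let $\mathbb R^N_+=\{x: x_\ell\ge 0\}$, and put $\Phi_j^\pm(x)=k_j^\pm\prod_\ell x_\ell^{\nu^\pm_{j\ell}}$ for $x\in\mathbb R^N_+$ and $\Phi_j^\pm=0$ on $\mathbb R^N\setminus\mathbb R^N_+$; assume that these zero-extended functions are locally Lipschitz on $\mathbb R^N$. Let $$H(p,x)=\sum_{j}\Big(\Phi_j^+(x)(e^{\nu_j\cdot p}-1)+\Phi_j^-(x)(e^{-\nu_j\cdot p}-1)\Big).$$ For $h>0$ and $i\in\mathbb Z^N$ let $x_i=hi$, let $\tilde\Phi_j^\pm(x_i)=k_j^\pm\prod_\ell \frac{i_\ell!\,h^{\nu^\pm_{j\ell}}}{(i_\ell-\nu^\pm_{j\ell})!}$ if $i_\ell\ge\nu^\pm_{j\ell}$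 for all $\ell$ and $\tilde\Phi_j^\pm(x_i)=0$ otherwise, and for a function $w$ on the grid $\Omega_h=\{hi: i\in\mathbb Z^N\}$ let $$H_h(w)(x_i)=\sum_{j:\,x_i+\nu_jh\ge0}\tilde\Phi_j^+(x_i)\Big(e^{\frac{w(x_i+\nu_jh)-w(x_i)}h}-1\Big)+\sum_{j:\,x_i-\nu_jh\ge0}\tilde\Phi_j^-(x_i)\Big(e^{\frac{w(x_i-\nu_jh)-w(x_i)}h}-1\Big).$$ Let $u^0\in C^2(\mathbb R^N)$ be constant on $\{x\in\mathbb R^N_+:|x|\ge r\}$ for some $r$. Let $T>0$ be a time up to which the bicharacteristics of $\partial_tu=H(\nabla u,x)$ exist uniquely: for every $x_0\in\mathbb R^N_+$ the system $\dot x=-\nabla_pH(p,x)$, $\dot p=\nabla_xH(p,x)$, $x(0)=x_0$, $p(0)=\nabla u^0(x_0)$ has a solution on $[0,T]$ with $x(t)\in\mathbb R^N_+$, and for every $t\in[0,T]$ the map $x_0\mapsto x(t)$ is a bijection of $\mathbb R^N_+$ onto itself with everywhere invertible differential. (On $\partial\mathbb R^N_+$ the gradient $\nabla_xH$ is the one-sided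 gradient from inside $\mathbb R^N_+$; off $\mathbb R^N_+$, $H=0$ and the bicharacteristics are constant.) Then $\partial_tu=H(\nabla u,x)$, $u(\cdot,0)=u^0$, has a unique classical solution $u$ on $\mathbb R^N\times[0,T]$, where classical means: continuous on $\mathbb R^N\times[0,T]$, $C^1$ on $\mathbb R^N_+\times[0,T]$ up to the boundary and on $(\mathbb R^N\setminus\mathbb R^N_+)\times[0,T]$, with the equation holding at every point (with the one-sided gradient on $\partial\mathbb R^N_+$). Moreover, for every $C_0$ there is $C>0$, independent of $h$, $\Delta t$, $n$ and of the discrete data, such that for every $h>0$ and every grid function $u_h^0$ with $\|u_h^0-u^0\|_{\ell^\infty(\Omega_h)}\le C_0h$: (i) for every $\Delta t>0$, every solution of the backward Euler scheme $\frac{u_h^n-u_h^{n-1}}{\Delta t}=H_h(u_h^n)$, $n\ge1$, $t^n=n\Delta t\le T$, with initial data $u_h^0$ satisfies $\|u_h^n-u(\cdot,t^n)\|_{\ell^\infty(\Omega_h)}\le C(T+1)(\Delta t+h)$ for all $n\ge 0$ with $t^n\le T$; (ii) every solution of the monotone scheme $\partial_tu_h=H_h(u_h)$ on $(0,T)$,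 continuous in time on $[0,T]$ at each grid point, with $u_h(\cdot,0)=u_h^0$, satisfies $\|u_h(\cdot,t)-u(\cdot,t)\|_{\ell^\infty(\Omega_h)}\le Ch$ for all $0<t\le T$. -/

import Mathlib

open Set

noncomputable section

namespace ChemHJE

/-- Concentration space `ℝ^N` with its Euclidean structure. -/
abbrev Conc (N : ℕ) : Type := EuclideanSpace ℝ (Fin N)

/-- The closed orthant `ℝ^N_+ = {x ; x_ℓ ≥ 0}`. -/
def orthant (N : ℕ) : Set (Conc N) := {x | ∀ l, 0 ≤ x l}

/-- A chemical reaction network with `N` species and `M` reversible reactions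
`∑ ν⁺_{jℓ} X_ℓ ⇌ ∑ ν⁻_{jℓ} X_ℓ`, with rate constants `k⁺_j, k⁻_j ≥ 0`. -/
structure ReactionNetwork (N M : ℕ) where
  /-- stoichiometric coefficients `ν⁺_{jℓ}` -/
  nuPlus : Fin M → Fin N → ℕ
  /-- stoichiometric coefficients `ν⁻_{jℓ}` -/
  nuMinus : Fin M → Fin N → ℕ
  /-- forward rate constants -/
  kPlus : Fin M → ℝ
  /-- backward rate constants -/
  kMinus : Fin M → ℝ
  kPlus_nonneg : ∀ j, 0 ≤ kPlus j
  kMinus_nonneg : ∀ j, 0 ≤ kMinus j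

/-- Macroscopic law of mass action `k ∏ x_ℓ^{a_ℓ}`, extended by zero off the orthant. -/
def massAction {N : ℕ} (k : ℝ) (a : Fin N → ℕ) : Conc N → ℝ :=
  (orthant N).indicator fun x => k * ∏ l, x l ^ a l

/-- Mesoscopic law of mass action `k ∏ (i_ℓ)! h^{a_ℓ} / (i_ℓ - a_ℓ)!` at the grid point `h i`;
it is zero if `i_ℓ < a_ℓ` for some `ℓ`, and zero if some `i_ℓ` is negative. -/
def mesoMassAction {N : ℕ} (k : ℝ) (a : Fin N → ℕ) (h : ℝ) (i : Fin N → ℤ) : ℝ :=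
  if ∀ l, 0 ≤ i l then k * ∏ l, (((i l).toNat.descFactorial (a l) : ℝ) * h ^ a l) else 0

/-- The grid point `x_i = h i` of `Ω_h = {h i ; i ∈ ℤ^N}`. -/
def gridPoint {N : ℕ} (h : ℝ) (i : Fin N → ℤ) : Conc N :=
  WithLp.toLp 2 fun l => h * (i l : ℝ)

namespace ReactionNetwork

variable {N M : ℕ} (R : ReactionNetwork N M)

/-- The reaction vector `ν_j = ν⁻_j - ν⁺_j ∈ ℤ^N`. -/
def nu (j : Fin M) : Fin N → ℤ := fun l => (R.nuMinus j l : ℤ) - (R.nuPlus j l : ℤ)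

/-- The pairing `ν_j · p`. -/
def nuDot (j : Fin M) (p : Conc N) : ℝ := ∑ l, (R.nu j l : ℝ) * p l

/-- Macroscopic forward flux `Φ⁺_j`, zero off the orthant. -/
def PhiPlus (j : Fin M) : Conc N → ℝ := massAction (R.kPlus j) (R.nuPlus j)

/-- Macroscopic backward flux `Φ⁻_j`, zero off the orthant. -/
def PhiMinus (j : Fin M) : Conc N → ℝ := massAction (R.kMinus j) (R.nuMinus j)

/-- Conservation of mass: some componentwise positive mass vector is orthogonal to all `ν_j`. -/
def ConservesMass : Prop :=
  ∃ m : Fin N → ℝ, (∀ l, 0 < m l) ∧ ∀ j, ∑ l, (R.nu j l : ℝ) * m l = 0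

/-- The zero-extended macroscopic fluxes are locally Lipschitz on `ℝ^N`. -/
def LocallyLipschitzRates : Prop :=
  ∀ j, LocallyLipschitz (R.PhiPlus j) ∧ LocallyLipschitz (R.PhiMinus j)

/-- The Hamiltonian `H(p, x)` on `ℝ^N × ℝ^N`. -/
def hamiltonian (p x : Conc N) : ℝ :=
  ∑ j, (R.PhiPlus j x * (Real.exp (R.nuDot j p) - 1)
    + R.PhiMinus j x * (Real.exp (-R.nuDot j p) - 1))

/-- The discrete Hamiltonian `H_h(x_i, w(x_i), w)` of a grid function `w`, with the
'no reaction' constraint `x_i ± ν_j h ≥ 0`. Grid functions are indexed by `i ∈ ℤ^N`. -/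
def discreteHamiltonian (h : ℝ) (w : (Fin N → ℤ) → ℝ) (i : Fin N → ℤ) : ℝ :=
  (∑ j, if ∀ l, 0 ≤ i l + R.nu j l then
      mesoMassAction (R.kPlus j) (R.nuPlus j) h i * (Real.exp ((w (i + R.nu j) - w i) / h) - 1)
    else 0)
  + ∑ j, if ∀ l, 0 ≤ i l - R.nu j l then
      mesoMassAction (R.kMinus j) (R.nuMinus j) h i * (Real.exp ((w (i - R.nu j) - w i) / h) - 1)
    else 0

/-- `w n`, `n Δt ≤ T`, solves the backward Euler scheme with time step `Δt` and initial
data `w0`. -/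
def IsBackwardEulerSolution (T h dt : ℝ) (w0 : (Fin N → ℤ) → ℝ)
    (w : ℕ → (Fin N → ℤ) → ℝ) : Prop :=
  w 0 = w0 ∧ ∀ n : ℕ, ((n + 1 : ℕ) : ℝ) * dt ≤ T → ∀ i,
    (w (n + 1) i - w n i) / dt - R.discreteHamiltonian h (w (n + 1)) i = 0

/-- `w t`, `0 ≤ t ≤ T`, solves the semi-discrete monotone scheme `∂_t w = H_h(w)` with initial
data `w0`. -/
def IsMonotoneSchemeSolution (T h : ℝ) (w0 : (Fin N → ℤ) → ℝ)
    (w : ℝ → (Fin N → ℤ) → ℝ) : Prop :=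
  w 0 = w0 ∧ ∀ i, ContinuousOn (fun t => w t i) (Icc 0 T) ∧
    ∀ t ∈ Ioo 0 T, HasDerivAt (fun s => w s i) (R.discreteHamiltonian h (w t) i) t

/-- `X t x₀`, `P t x₀` (`0 ≤ t ≤ T`, `x₀` in the orthant) are the bicharacteristics of
`∂_t u = H(∇u, x)` with initial data `u0`, i.e. the solutions of
`x' = -∇_p H(p, x)`, `p' = ∇_x H(p, x)`, `x(0) = x₀`, `p(0) = ∇u0(x₀)`. On the boundary of the
orthant `∇_x` is the one-sided gradient, from inside the orthant. Off the orthant `H` vanishes, so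
the bicharacteristics there are constant and need not be mentioned. -/
structure IsBicharacteristicFlow (u0 : Conc N → ℝ) (T : ℝ) (X P : ℝ → Conc N → Conc N) :
    Prop where
  mem : ∀ t ∈ Icc 0 T, ∀ x₀ ∈ orthant N, X t x₀ ∈ orthant N
  init_x : ∀ x₀ ∈ orthant N, X 0 x₀ = x₀
  init_p : ∀ x₀ ∈ orthant N, P 0 x₀ = gradient u0 x₀
  deriv_x : ∀ t ∈ Icc 0 T, ∀ x₀ ∈ orthant N,
    HasDerivWithinAt (fun s => X s x₀)
      (-gradient (fun p => R.hamiltonian p (X t x₀)) (P t x₀)) (Icc 0 T) t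
  deriv_p : ∀ t ∈ Icc 0 T, ∀ x₀ ∈ orthant N,
    HasDerivWithinAt (fun s => P s x₀)
      (gradientWithin (fun x => R.hamiltonian (P t x₀) x) (orthant N) (X t x₀)) (Icc 0 T) t

/-- Bicharacteristics exist uniquely up to time `T`: they exist on `[0, T]` from every starting
point, and for every `t ∈ [0, T]` exactly one of them passes through each point, without focusing,
i.e. `x₀ ↦ X t x₀` is a bijection with invertible differential. -/
def BicharacteristicsExistUniquely (u0 : Conc N → ℝ) (T : ℝ) : Prop :=
  ∃ X P : ℝ → Conc N → Conc N, R.IsBicharacteristicFlow u0 T X P ∧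
    ∀ t ∈ Icc 0 T, BijOn (X t) (orthant N) (orthant N) ∧
      ∀ x₀ ∈ orthant N, (fderivWithin ℝ (X t) (orthant N) x₀).IsInvertible

/-- `u` is a classical solution on `ℝ^N × [0, T]` of `∂_t u = H(∇u, x)`, `u(·, 0) = u0`: it is
continuous, it is `C¹` on the closed orthant (up to its boundary) and on the complement, and the
equation holds at every point. On the boundary of the orthant `∇u` is the one-sided gradient. -/
structure IsClassicalSolution (u0 : Conc N → ℝ) (T : ℝ) (u : ℝ → Conc N → ℝ) : Prop where
  init : ∀ x, u 0 x = u0 x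
  continuousOn : ContinuousOn (fun q : ℝ × Conc N => u q.1 q.2) (Icc 0 T ×ˢ univ)
  contDiffOn_orthant :
    ContDiffOn ℝ 1 (fun q : ℝ × Conc N => u q.1 q.2) (Icc 0 T ×ˢ orthant N)
  contDiffOn_compl :
    ContDiffOn ℝ 1 (fun q : ℝ × Conc N => u q.1 q.2) (Icc 0 T ×ˢ (orthant N)ᶜ)
  eq_orthant : ∀ t ∈ Icc 0 T, ∀ x ∈ orthant N,
    HasDerivWithinAt (fun s => u s x)
      (R.hamiltonian (gradientWithin (u t) (orthant N) x) x) (Icc 0 T) t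
  eq_compl : ∀ t ∈ Icc 0 T, ∀ x ∈ (orthant N)ᶜ,
    HasDerivWithinAt (fun s => u s x) (R.hamiltonian (gradient (u t) x) x) (Icc 0 T) t

end ReactionNetwork

/-- `u` is constant on the part of the orthant outside some ball. -/
def ConstAtInfinity {N : ℕ} (u : Conc N → ℝ) : Prop :=
  ∃ r c : ℝ, ∀ x ∈ orthant N, r ≤ ‖x‖ → u x = c

end ChemHJE

end

/-! The solution is built by the method of characteristics, and both schemes are compared with it
through a discrete maximum principle. Conservation of mass supplies the compactness. Since `H` sees
`p` only through `ν_j · p`, its `p`-gradient is orthogonal to `m`, so bicharacteristics stay on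
level sets of `m · x`; reactions on the grid do the same. Mass sublevels of the orthant are compact.
A characteristic of large mass starts where the datum is constant, so it has zero momentum and the
solution is constant there. This makes all constants uniform.

The delicate point is regularity up to the boundary of the orthant. The flow is not shown to be `C¹`
and no inverse function theorem is invoked; it suffices that `X t` is bi-Lipschitz on a sublevel,
uniformly in time. `exists_strict_fderivWithin` upgrades pointwise differentiability of the flow to
strict differentiability, and with injectivity and compactness this gives the lower bound
`exists_antilipschitz`. Along neighbouring characteristics the action differs by momentum times
displacement up to a quadratic error (`exists_action_bound`), because the first order terms cancel
along a Hamiltonian flow. Rewritten in terms of endpoints, this says that the solution has a spatial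
Taylor expansion with quadratic remainder and that its gradient, the transported momentum, is
Lipschitz in time and space (`exists_charSolution_bounds`). The equation and joint `C¹` regularity
follow; second derivatives are never used.

Off the orthant `H = 0`. The zero-extended rates are continuous, so `H` also vanishes on the closure
of the complement; there the solution keeps its initial value, and the two pieces glue. For
uniqueness, a positive maximum of `u - v - εt` over a mass level lies at an interior point and a
positive time. There the derivatives along every `ν_j` agree, hence so do the Hamiltonians, which is
incompatible with `ε > 0`.

For convergence, at a maximum of `w - v` over a finite grid level the discrete Hamiltonian of `w` is
at most that of `v`, so consistency errors accumulate at most linearly in time. These errors are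
`O(h)` from the factorial rates and the quadratic Taylor remainder, plus `O(Δt)` for backward Euler,
because the time derivative of the solution is Lipschitz in time. -/

noncomputable section

namespace ChemHJE

/-! ### Grönwall, barrier and Taylor estimates -/

section Estimates

variable {V W : Type*} [NormedAddCommGroup V] [NormedSpace ℝ V] [NormedAddCommGroup W]
  [NormedSpace ℝ W]

/-- Grönwall's inequality on `[0, T]`, with a bound that does not depend on time. -/
theorem norm_le_of_norm_deriv_le {f f' : ℝ → V} {T K ε δ : ℝ} (hK : 0 ≤ K) (hε : 0 ≤ ε)
    (hf : ∀ t ∈ Icc 0 T, HasDerivWithinAt f (f' t) (Icc 0 T) t) (h0 : ‖f 0‖ ≤ δ)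
    (hb : ∀ t ∈ Icc 0 T, ‖f' t‖ ≤ K * ‖f t‖ + ε) :
    ∀ t ∈ Icc 0 T, ‖f t‖ ≤ (δ + ε * T) * Real.exp (K * T) := by
  intro t ht
  have hδ : 0 ≤ δ := (norm_nonneg _).trans h0
  have hT : 0 ≤ T := ht.1.trans ht.2
  have key := norm_le_gronwallBound_of_norm_deriv_right_le (f := f) (f' := f') (δ := δ) (K := K)
    (ε := ε) (a := 0) (b := T) (fun s hs => (hf s hs).continuousWithinAt)
    (fun s hs => (hf s (Ico_subset_Icc_self hs)).mono_of_mem_nhdsWithin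
      (Icc_mem_nhdsGE_of_mem hs)) h0 (fun s hs => hb s (Ico_subset_Icc_self hs)) t ht
  refine key.trans ((gronwallBound_mono hδ hε hK (by linarith [ht.2] : t - 0 ≤ T)).trans ?_)
  rcases hK.eq_or_lt with rfl | hK
  · simp [gronwallBound_K0]
  · rw [gronwallBound_of_K_ne_0 hK.ne']
    -- Multiplying `1 - KT ≤ e^{-KT}` by `e^{KT}` gives `e^{KT} - 1 ≤ KT e^{KT}`, which removes the
    -- division by `K`.
    have h1 := Real.add_one_le_exp (-(K * T))
    have h2 : Real.exp (K * T) * Real.exp (-(K * T)) = 1 := by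
      rw [← Real.exp_add]; simp
    have h3 : Real.exp (K * T) - 1 ≤ K * T * Real.exp (K * T) := by
      nlinarith [Real.exp_pos (K * T)]
    have h4 : ε / K * (Real.exp (K * T) - 1) ≤ ε / K * (K * T * Real.exp (K * T)) := by
      gcongr
    have h5 : ε / K * (K * T * Real.exp (K * T)) = ε * T * Real.exp (K * T) := by
      field_simp
    linarith

/-- A function on `[0, T]` that cannot reach the barrier `b` while staying below it. -/
theorem lt_of_forall_le_imp_lt {f : ℝ → ℝ} {T b : ℝ} (hf : ContinuousOn f (Icc 0 T))
    (h0 : f 0 < b) (h : ∀ t ∈ Icc 0 T, (∀ s ∈ Icc 0 t, f s ≤ b) → f t < b) :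
    ∀ t ∈ Icc 0 T, f t < b := by
  by_contra! hcon
  obtain ⟨t₁, ht₁, hb₁⟩ := hcon
  have hcl : IsCompact (Icc 0 T ∩ f ⁻¹' Ici b) :=
    isCompact_Icc.of_isClosed_subset (hf.preimage_isClosed_of_isClosed isClosed_Icc isClosed_Ici)
      inter_subset_left
  -- The first time at which the barrier is reached. By continuity from the left the value there is
  -- still at most `b`, so the hypothesis applies at this time and contradicts reaching `b`.
  obtain ⟨t, ⟨ht, hbt⟩, hmin⟩ := hcl.exists_isLeast ⟨t₁, ht₁, hb₁⟩
  have hlt : ∀ s ∈ Ico 0 t, f s < b := by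
    intro s hs
    by_contra! hs'
    exact absurd (hmin ⟨⟨hs.1, hs.2.le.trans ht.2⟩, hs'⟩) (not_le.2 hs.2)
  have ht0 : 0 < t := by
    rcases ht.1.eq_or_lt with rfl | h'
    · exact absurd hbt (not_le.2 h0)
    · exact h'
  have hft : f t ≤ b := by
    have hc : ContinuousOn f (closure (Ico 0 t)) := by
      rw [closure_Ico ht0.ne]
      exact hf.mono (Icc_subset_Icc_right ht.2)
    refine le_on_closure (fun s hs => (hlt s hs).le) hc continuousOn_const ?_
    rw [closure_Ico ht0.ne]
    exact right_mem_Icc.2 ht.1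
  refine absurd (h t ht fun s hs => ?_) (not_lt.2 hbt)
  rcases hs.2.eq_or_lt with rfl | h'
  · exact hft
  · exact (hlt s ⟨hs.1, h'⟩).le

theorem exists_lipschitz_closedBall [ProperSpace V] {F : V → W} (hF : ContDiff ℝ 1 F) (r : ℝ) :
    ∃ L : ℝ, 0 ≤ L ∧ ∀ a ∈ Metric.closedBall (0 : V) r, ∀ b ∈ Metric.closedBall (0 : V) r,
      ‖F a - F b‖ ≤ L * ‖a - b‖ := by
  obtain ⟨L, hL⟩ := (isCompact_closedBall (0 : V) r).exists_bound_of_continuousOn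
    (hF.continuous_fderiv one_ne_zero).continuousOn
  refine ⟨max L 0, le_max_right _ _, fun a ha b hb => ?_⟩
  exact (convex_closedBall (0 : V) r).norm_image_sub_le_of_norm_fderiv_le
    (fun x _ => hF.differentiable one_ne_zero x) (fun x hx => (hL x hx).trans (le_max_left _ _))
    hb ha

theorem exists_bound_closedBall {V W : Type*} [NormedAddCommGroup V] [NormedAddCommGroup W]
    [ProperSpace V] {F : V → W} (hF : Continuous F) (r : ℝ) :
    ∃ L : ℝ, 0 ≤ L ∧ ∀ a ∈ Metric.closedBall (0 : V) r, ‖F a‖ ≤ L := by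
  obtain ⟨L, hL⟩ := (isCompact_closedBall (0 : V) r).exists_bound_of_continuousOn hF.continuousOn
  exact ⟨max L 0, le_max_right _ _, fun a ha => (hL a ha).trans (le_max_left _ _)⟩

/-- Uniform continuity of the derivative on the compact ball, followed by the mean value inequality
on the convex intersection of two balls. As `ρ` does not depend on `c`, it can be used along a whole
trajectory. -/
theorem exists_uniform_strict_fderiv [ProperSpace V] {F : V → W} (hF : ContDiff ℝ 1 F) (r : ℝ)
    {κ : ℝ} (hκ : 0 < κ) :
    ∃ ρ : ℝ, 0 < ρ ∧ ∀ a ∈ Metric.closedBall (0 : V) r, ∀ b ∈ Metric.closedBall (0 : V) r,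
      ∀ c ∈ Metric.closedBall (0 : V) r, ‖a - c‖ < ρ → ‖b - c‖ < ρ →
      ‖F a - F b - fderiv ℝ F c (a - b)‖ ≤ κ * ‖a - b‖ := by
  have hu := (isCompact_closedBall (0 : V) r).uniformContinuousOn_of_continuous
    (hF.continuous_fderiv one_ne_zero).continuousOn
  obtain ⟨ρ, hρ, h⟩ := Metric.uniformContinuousOn_iff.1 hu κ hκ
  refine ⟨ρ, hρ, fun a ha b hb c hc hac hbc => ?_⟩
  refine ((convex_closedBall (0 : V) r).inter
    (convex_ball c ρ)).norm_image_sub_le_of_norm_fderiv_le'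
    (fun x _ => hF.differentiable one_ne_zero x) (fun x hx => ?_)
    ⟨hb, by rwa [Metric.mem_ball, dist_eq_norm]⟩ ⟨ha, by rwa [Metric.mem_ball, dist_eq_norm]⟩
  rw [← dist_eq_norm]
  exact (h x hx.1 c hc hx.2).le

theorem exists_taylor_two_closedBall [ProperSpace V] {F : V → W} (hF : ContDiff ℝ 2 F) (r : ℝ) :
    ∃ C : ℝ, 0 ≤ C ∧ ∀ a ∈ Metric.closedBall (0 : V) r, ∀ b ∈ Metric.closedBall (0 : V) r,
      ‖F a - F b - fderiv ℝ F b (a - b)‖ ≤ C * ‖a - b‖ ^ 2 := by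
  obtain ⟨C, hC, h⟩ := exists_lipschitz_closedBall
    (hF.fderiv_right (m := 1) (by norm_num)) r
  refine ⟨C, hC, fun a ha b hb => ?_⟩
  rw [pow_two, ← mul_assoc]
  refine ((convex_closedBall (0 : V) r).inter
    (convex_closedBall b ‖a - b‖)).norm_image_sub_le_of_norm_fderiv_le'
    (fun x _ => hF.differentiable two_ne_zero x) (fun x hx => ?_)
    ⟨hb, by simp⟩ ⟨ha, by rw [Metric.mem_closedBall, dist_eq_norm]⟩
  refine (h x hx.1 b hb).trans ?_
  gcongr
  rw [← dist_eq_norm]; exact hx.2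

end Estimates

/-! ### Dependence of trajectories on the initial point -/

section Trajectories

variable {E V : Type*} [NormedAddCommGroup V] [NormedSpace ℝ V]

/-- `Z · x`, for `x ∈ D`, is a solution on `[0, T]` of `z' = F z`, `z(0) = z0 x`. -/
structure IsTrajectoryFamily (F : V → V) (D : Set E) (T : ℝ) (z0 : E → V) (Z : ℝ → E → V) :
    Prop where
  init : ∀ x ∈ D, Z 0 x = z0 x
  deriv : ∀ t ∈ Icc 0 T, ∀ x ∈ D, HasDerivWithinAt (fun s => Z s x) (F (Z t x)) (Icc 0 T) t

namespace IsTrajectoryFamily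

variable {F : V → V} {D A : Set E} {T : ℝ} {z0 : E → V} {Z : ℝ → E → V}

theorem continuousOn (hZ : IsTrajectoryFamily F D T z0 Z) {x : E} (hx : x ∈ D) :
    ContinuousOn (fun s => Z s x) (Icc 0 T) :=
  fun t ht => (hZ.deriv t ht x hx).continuousWithinAt

theorem deriv_sub (hZ : IsTrajectoryFamily F D T z0 Z) {x y : E} (hx : x ∈ D) (hy : y ∈ D)
    {t : ℝ} (ht : t ∈ Icc 0 T) :
    HasDerivWithinAt (fun s => Z s y - Z s x) (F (Z t y) - F (Z t x)) (Icc 0 T) t :=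
  (hZ.deriv t ht y hy).sub (hZ.deriv t ht x hx)

variable [NormedAddCommGroup E]

/-- A bootstrap that replaces a global Lipschitz bound on `F`: while the second trajectory stays
within distance 1 of the first, one local Lipschitz constant applies, and Grönwall then keeps the
distance strictly below 1. -/
theorem exists_near [ProperSpace V] (hF : ContDiff ℝ 1 F) (hz0 : Continuous z0)
    (hZ : IsTrajectoryFamily F D T z0 Z) {x : E} (hx : x ∈ D) :
    ∃ δ > 0, ∀ y ∈ D, ‖y - x‖ < δ → ∀ t ∈ Icc 0 T, ‖Z t y - Z t x‖ ≤ 1 := by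
  obtain ⟨r, hr⟩ := isCompact_Icc.exists_bound_of_continuousOn (hZ.continuousOn hx)
  obtain ⟨L, hL0, hL⟩ := exists_lipschitz_closedBall hF (r + 1)
  -- An initial distance of this size grows by a factor of at most `e^{LT}`, hence stays at most
  -- 1/2.
  have hpos : 0 < Real.exp (-(L * T)) / 2 := by positivity
  obtain ⟨δ, hδ, hδ'⟩ := Metric.continuous_iff.1 hz0 x _ hpos
  have hexp : ∀ t ∈ Icc 0 T, Real.exp (-(L * T)) / 2 * Real.exp (L * t) < 1 := by
    intro t ht
    have h1 : Real.exp (-(L * T)) * Real.exp (L * t) ≤ 1 := by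
      rw [← Real.exp_add, Real.exp_le_one_iff]
      nlinarith [ht.2]
    linarith
  refine ⟨δ, hδ, fun y hy hyx t ht => ?_⟩
  have h0T : (0 : ℝ) ∈ Icc 0 T := ⟨le_rfl, ht.1.trans ht.2⟩
  have h0 : ‖Z 0 y - Z 0 x‖ ≤ Real.exp (-(L * T)) / 2 := by
    rw [hZ.init x hx, hZ.init y hy, ← dist_eq_norm]
    exact (hδ' y (by rwa [dist_eq_norm])).le
  refine (lt_of_forall_le_imp_lt (f := fun t => ‖Z t y - Z t x‖) (b := 1) (T := T)
    ((hZ.continuousOn hy).sub (hZ.continuousOn hx)).norm ?_ ?_ t ht).le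
  · refine h0.trans_lt ?_
    simpa using hexp 0 h0T
  · intro t ht hs
    have hsub : Icc 0 t ⊆ Icc 0 T := Icc_subset_Icc_right ht.2
    refine lt_of_le_of_lt ?_ (hexp t ht)
    have := norm_le_of_norm_deriv_le (f := fun s => Z s y - Z s x)
      (f' := fun s => F (Z s y) - F (Z s x)) (T := t) (K := L) (ε := 0) hL0 le_rfl
      (fun s hs => (hZ.deriv_sub hx hy (hsub hs)).mono hsub) h0 ?_ t ⟨ht.1, le_rfl⟩
    · simpa using this
    · intro s hs'
      rw [add_zero]
      have hx1 : ‖Z s x‖ ≤ r := hr s (hsub hs')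
      have := norm_sub_norm_le (Z s y) (Z s x)
      refine hL _ ?_ _ ?_
      · rw [mem_closedBall_zero_iff]; linarith [hs s hs']
      · rw [mem_closedBall_zero_iff]; linarith

theorem exists_bound [ProperSpace V] (hF : ContDiff ℝ 1 F) (hz0 : Continuous z0)
    (hZ : IsTrajectoryFamily F D T z0 Z) (hA : IsCompact A) (hAD : A ⊆ D) :
    ∃ B : ℝ, ∀ t ∈ Icc 0 T, ∀ x ∈ A, ‖Z t x‖ ≤ B := by
  refine hA.induction_on (p := fun S => ∃ B : ℝ, ∀ t ∈ Icc 0 T, ∀ x ∈ S, ‖Z t x‖ ≤ B)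
    ⟨0, by simp⟩ ?_ ?_ ?_
  · rintro S S' hSS ⟨B, hB⟩
    exact ⟨B, fun t ht x hx => hB t ht x (hSS hx)⟩
  · rintro S S' ⟨B, hB⟩ ⟨B', hB'⟩
    refine ⟨max B B', fun t ht x hx => hx.elim (fun h => ?_) (fun h => ?_)⟩
    · exact (hB t ht x h).trans (le_max_left _ _)
    · exact (hB' t ht x h).trans (le_max_right _ _)
  · intro x hx
    obtain ⟨δ, hδ, h⟩ := hZ.exists_near hF hz0 (hAD hx)
    obtain ⟨r, hr⟩ := isCompact_Icc.exists_bound_of_continuousOn (hZ.continuousOn (hAD hx))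
    refine ⟨A ∩ Metric.ball x δ, inter_mem_nhdsWithin _ (Metric.ball_mem_nhds x hδ), r + 1, ?_⟩
    rintro t ht y ⟨hyA, hy⟩
    have h1 := h y (hAD hyA) (by rwa [← dist_eq_norm]) t ht
    have h2 : ‖Z t x‖ ≤ r := hr t ht
    have := norm_sub_norm_le (Z t y) (Z t x)
    linarith

/-- Uniform bounds for a family of trajectories that start in a compact set: boundedness, Lipschitz
dependence on the initial point and on time, and on time for differences. -/
theorem exists_uniform_bounds [NormedSpace ℝ E] [ProperSpace V] [ProperSpace E] (hF : ContDiff ℝ 1 F)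
    (hz0 : ContDiff ℝ 1 z0) (hZ : IsTrajectoryFamily F D T z0 Z) (hA : IsCompact A)
    (hAD : A ⊆ D) :
    ∃ B L : ℝ, 0 ≤ L ∧ (∀ t ∈ Icc 0 T, ∀ x ∈ A, ‖Z t x‖ ≤ B) ∧
      (∀ t ∈ Icc 0 T, ∀ x ∈ A, ∀ y ∈ A, ‖Z t y - Z t x‖ ≤ L * ‖y - x‖) ∧
      (∀ t ∈ Icc 0 T, ∀ s ∈ Icc 0 T, ∀ x ∈ A, ‖Z t x - Z s x‖ ≤ L * |t - s|) ∧
      (∀ t ∈ Icc 0 T, ∀ s ∈ Icc 0 T, ∀ x ∈ A, ∀ y ∈ A,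
        ‖(Z t y - Z t x) - (Z s y - Z s x)‖ ≤ L * |t - s| * ‖y - x‖) := by
  obtain ⟨B, hB⟩ := hZ.exists_bound hF hz0.continuous hA hAD
  obtain ⟨r, hr⟩ := hA.isBounded.subset_closedBall (0 : E)
  obtain ⟨L₀, hL₀, hz⟩ := exists_lipschitz_closedBall hz0 r
  obtain ⟨L₁, hL₁, hF1⟩ := exists_lipschitz_closedBall hF B
  obtain ⟨L₂, hL₂, hF2⟩ := exists_bound_closedBall hF.continuous B
  have hmem : ∀ t ∈ Icc 0 T, ∀ x ∈ A, Z t x ∈ Metric.closedBall (0 : V) B := fun t ht x hx => by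
    rw [mem_closedBall_zero_iff]; exact hB t ht x hx
  have hlip : ∀ t ∈ Icc 0 T, ∀ x ∈ A, ∀ y ∈ A,
      ‖Z t y - Z t x‖ ≤ L₀ * Real.exp (L₁ * T) * ‖y - x‖ := by
    intro t ht x hx y hy
    have := norm_le_of_norm_deriv_le (f := fun s => Z s y - Z s x)
      (f' := fun s => F (Z s y) - F (Z s x)) (T := T) (K := L₁) (ε := 0) (δ := L₀ * ‖y - x‖)
      hL₁ le_rfl (fun s hs => hZ.deriv_sub (hAD hx) (hAD hy) hs) ?_ ?_ t ht
    · refine this.trans_eq ?_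
      ring
    · rw [hZ.init x (hAD hx), hZ.init y (hAD hy)]
      exact hz y (hr hy) x (hr hx)
    · intro s hs
      rw [add_zero]
      exact hF1 _ (hmem s hs y hy) _ (hmem s hs x hx)
  set L := L₀ * Real.exp (L₁ * T) with hLdef
  have hL : 0 ≤ L := by positivity
  -- The three summands serve the three estimates: `L` for initial points, `L₂` for the speed, `L₁ *
  -- L` for the speed of differences.
  refine ⟨B, L + L₂ + L₁ * L, by positivity, hB, ?_, ?_, ?_⟩
  · intro t ht x hx y hy
    refine (hlip t ht x hx y hy).trans ?_
    gcongr
    nlinarith [mul_nonneg hL₁ hL]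
  · intro t ht s hs x hx
    have := (convex_Icc (0 : ℝ) T).norm_image_sub_le_of_norm_hasDerivWithin_le
      (fun τ hτ => hZ.deriv τ hτ x (hAD hx)) (fun τ hτ => hF2 _ (hmem τ hτ x hx)) hs ht
    refine this.trans ?_
    rw [Real.norm_eq_abs]
    gcongr
    nlinarith [mul_nonneg hL₁ hL]
  · intro t ht s hs x hx y hy
    have := (convex_Icc (0 : ℝ) T).norm_image_sub_le_of_norm_hasDerivWithin_le
      (C := L₁ * (L * ‖y - x‖)) (fun τ hτ => hZ.deriv_sub (hAD hx) (hAD hy) hτ) (fun τ hτ => ?_)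
      hs ht
    · refine this.trans ?_
      rw [Real.norm_eq_abs]
      have h1 : 0 ≤ |t - s| * ‖y - x‖ := by positivity
      nlinarith [mul_nonneg hL h1, mul_nonneg hL₂ h1]
    · refine (hF1 _ (hmem τ hτ y hy) _ (hmem τ hτ x hx)).trans ?_
      gcongr
      exact hlip τ hτ x hx y hy

end IsTrajectoryFamily

end Trajectories

/-! ### Strict differentiability and uniform expansiveness of the flow -/

/-- Used with `w₀` the linearization error for the displacement `v` and `w i` the error for a
coordinate step of length `ε`. All have relative size `c`, and `|v i| ≤ ‖v‖` yields the factor `1 +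
N`. -/
theorem norm_sub_sum_smul_le {N : ℕ} {V : Type*} [NormedAddCommGroup V] [NormedSpace ℝ V]
    (v : EuclideanSpace ℝ (Fin N)) {ε c : ℝ} (hε : 0 < ε) (w₀ : V) (w : Fin N → V)
    (h₀ : ‖w₀‖ ≤ c * ‖v‖) (h : ∀ i, ‖w i‖ ≤ c * ε) :
    ‖w₀ - ∑ i, (v i / ε) • w i‖ ≤ c * (1 + N) * ‖v‖ := by
  have h1 : ‖∑ i, (v i / ε) • w i‖ ≤ ∑ _i : Fin N, c * ‖v‖ := by
    refine norm_sum_le_of_le _ fun i _ => ?_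
    rw [norm_smul, norm_div, Real.norm_of_nonneg hε.le]
    calc ‖v i‖ / ε * ‖w i‖ ≤ ‖v‖ / ε * (c * ε) := by
          gcongr
          · exact PiLp.norm_apply_le v i
          · exact h i
      _ = c * ‖v‖ := by field_simp
  refine (norm_sub_le _ _).trans ((add_le_add h₀ h1).trans_eq ?_)
  simp
  ring

theorem sum_div_smul_smul_single {N : ℕ} (v : EuclideanSpace ℝ (Fin N)) {ε : ℝ} (hε : ε ≠ 0) :
    ∑ i, (v i / ε) • (ε • EuclideanSpace.single i (1 : ℝ)) = v := by
  ext j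
  simp [smul_smul, hε, Finset.sum_apply, Pi.single_apply]

theorem sum_div_smul_map {N : ℕ} {U : Type*} [NormedAddCommGroup U] [NormedSpace ℝ U]
    (v : EuclideanSpace ℝ (Fin N)) {ε : ℝ} (hε : ε ≠ 0) (l : EuclideanSpace ℝ (Fin N) →L[ℝ] U) :
    ∑ i, (v i / ε) • l (ε • EuclideanSpace.single i (1 : ℝ)) = l v := by
  conv_rhs => rw [← sum_div_smul_smul_single v hε, map_sum]
  simp only [map_smul]

namespace IsTrajectoryFamily

variable {N : ℕ} {V : Type*} [NormedAddCommGroup V] [NormedSpace ℝ V] [ProperSpace V]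
  {F : V → V} {D A : Set (Conc N)} {T : ℝ} {z0 : Conc N → V} {Z : ℝ → Conc N → V}

/-- Near a reference point, differences of trajectories solve the linearized initial value problem
up to a small relative error. -/
theorem exists_linearization (hF : ContDiff ℝ 1 F) (hz0 : ContDiff ℝ 1 z0) (hDc : IsClosed D)
    (hZ : IsTrajectoryFamily F D T z0 Z) {x : Conc N} (hx : x ∈ D) :
    ∃ a L : ℝ, 0 ≤ a ∧ 0 ≤ L ∧ (∀ t ∈ Icc 0 T, ‖fderiv ℝ F (Z t x)‖ ≤ a) ∧
      ∀ κ > 0, ∃ δ > 0, ∀ y ∈ D, ∀ z ∈ D, ‖y - x‖ < δ → ‖z - x‖ < δ →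
        ‖(Z 0 y - Z 0 z) - fderiv ℝ z0 x (y - z)‖ ≤ κ * ‖y - z‖ ∧
        ∀ t ∈ Icc 0 T, ‖(F (Z t y) - F (Z t z)) - fderiv ℝ F (Z t x) (Z t y - Z t z)‖
          ≤ κ * L * ‖y - z‖ := by
  set S := D ∩ Metric.closedBall x 1 with hS
  have hSc : IsCompact S := (isCompact_closedBall x 1).inter_left hDc
  obtain ⟨B, L, hL, hB, hlip, -, -⟩ := hZ.exists_uniform_bounds hF hz0 hSc inter_subset_left
  obtain ⟨a, ha, hFa⟩ := exists_bound_closedBall (hF.continuous_fderiv one_ne_zero) B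
  have hxS : x ∈ S := ⟨hx, by simp⟩
  have hmem : ∀ t ∈ Icc 0 T, ∀ y ∈ S, Z t y ∈ Metric.closedBall (0 : V) B := fun t ht y hy => by
    rw [mem_closedBall_zero_iff]; exact hB t ht y hy
  refine ⟨a, L, ha, hL, fun t ht => hFa _ (hmem t ht x hxS), fun κ hκ => ?_⟩
  obtain ⟨ρ, hρ, hstrict⟩ := exists_uniform_strict_fderiv hF B hκ
  obtain ⟨ρ₀, hρ₀, hstrict₀⟩ := exists_uniform_strict_fderiv hz0 (‖x‖ + 1) hκ
  have hball : ∀ y, ‖y - x‖ < 1 → y ∈ Metric.closedBall (0 : Conc N) (‖x‖ + 1) := by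
    intro y hy
    have := norm_sub_norm_le y x
    rw [mem_closedBall_zero_iff]; linarith
  -- 1 keeps the points in `S`, `ρ₀` handles the initial data, and `ρ / (L + 1)` keeps the
  -- trajectories within `ρ` of the reference one at all times.
  refine ⟨min 1 (min ρ₀ (ρ / (L + 1))), by positivity, fun y hy z hz hyx hzx => ?_⟩
  simp only [lt_min_iff] at hyx hzx
  have hyS : y ∈ S := ⟨hy, by rw [Metric.mem_closedBall, dist_eq_norm]; exact hyx.1.le⟩
  have hzS : z ∈ S := ⟨hz, by rw [Metric.mem_closedBall, dist_eq_norm]; exact hzx.1.le⟩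
  refine ⟨?_, fun t ht => ?_⟩
  · rw [hZ.init y hy, hZ.init z hz]
    exact hstrict₀ y (hball y hyx.1) z (hball z hzx.1) x (by simp) hyx.2.1 hzx.2.1
  · have hρ' : ∀ y ∈ S, ‖y - x‖ < ρ / (L + 1) → ‖Z t y - Z t x‖ < ρ := by
      intro y hy hyx
      have h1 := hlip t ht x hxS y hy
      rw [lt_div_iff₀ (by positivity)] at hyx
      nlinarith [norm_nonneg (y - x)]
    refine (hstrict _ (hmem t ht y hyS) _ (hmem t ht z hzS) _ (hmem t ht x hxS)
      (hρ' y hyS hyx.2.2) (hρ' z hzS hzx.2.2)).trans ?_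
    rw [mul_assoc]
    gcongr
    exact hlip t ht z hzS y hyS

/-- A component of the flow that is differentiable at a point is strictly differentiable there. The
linearized equation is not solved: its solutions are replaced by difference quotients of
trajectories in the coordinate directions. -/
theorem exists_strict_fderivWithin (hF : ContDiff ℝ 1 F) (hz0 : ContDiff ℝ 1 z0)
    (hDc : IsClosed D)
    (hD : ∀ x ∈ D, ∀ i, ∀ ε : ℝ, 0 ≤ ε → x + ε • EuclideanSpace.single i (1 : ℝ) ∈ D)
    (hZ : IsTrajectoryFamily F D T z0 Z) (π : V →L[ℝ] Conc N) {x : Conc N} (hx : x ∈ D) {t : ℝ}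
    (ht : t ∈ Icc 0 T) {G : Conc N →L[ℝ] Conc N}
    (hG : HasFDerivWithinAt (fun y => π (Z t y)) G D x) {η : ℝ} (hη : 0 < η) :
    ∃ δ > 0, ∀ y ∈ D, ∀ z ∈ D, ‖y - x‖ < δ → ‖z - x‖ < δ →
      ‖π (Z t y) - π (Z t z) - G (y - z)‖ ≤ η * ‖y - z‖ := by
  obtain ⟨a, L, ha, hL, hDF, hlin⟩ := hZ.exists_linearization hF hz0 hDc hx
  have hT : 0 ≤ T := ht.1.trans ht.2
  -- The final relative error is `κ * Q`: the Grönwall term comes from linearizing the initial data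
  -- and the equation, and the last 1 from differentiability of the component at `x`.
  set Q : ℝ := (1 + N) * (‖π‖ * ((1 + L * T) * Real.exp (a * T)) + 1) with hQ
  have hQpos : 0 < Q := by positivity
  set κ := η / Q with hκdef
  have hκ : 0 < κ := by positivity
  obtain ⟨δ, hδ, hlinκ⟩ := hlin κ hκ
  have hG' := hG.isLittleO.def hκ
  obtain ⟨δ₁, hδ₁, hGδ⟩ := Metric.mem_nhdsWithin_iff.1 hG'
  refine ⟨δ, hδ, fun y hy z hz hyx hzx => ?_⟩
  -- One fixed step length. Differentiability at `x` is used only for the increments `e i`, which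
  -- remain in `D` because they point in positive directions, while `y - z` is arbitrary.
  set ε := min δ δ₁ / 2 with hεdef
  have hε : 0 < ε := by positivity
  have hεδ : ε < δ := (half_lt_self (by positivity)).trans_le (min_le_left _ _)
  have hεδ₁ : ε < δ₁ := (half_lt_self (by positivity)).trans_le (min_le_right _ _)
  set e : Fin N → Conc N := fun i => ε • EuclideanSpace.single i (1 : ℝ) with he
  have hxe : ∀ i, x + e i ∈ D := fun i => hD x hx i ε hε.le
  have hne : ∀ i, ‖e i‖ = ε := fun i => by simp [he, norm_smul, abs_of_pos hε]
  have hxx : ‖x - x‖ < δ := by simpa using hδ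
  have hei : ∀ i, ‖x + e i - x‖ < δ := fun i => by rw [add_sub_cancel_left, hne]; exact hεδ
  set v := y - z with hv
  have hsumG : ∑ i, (v i / ε) • G (e i) = G v := sum_div_smul_map v hε.ne' G
  have hsum0 : ∑ i, (v i / ε) • fderiv ℝ z0 x (e i) = fderiv ℝ z0 x v :=
    sum_div_smul_map v hε.ne' _
  -- The difference `Z y - Z z` and the matching combination of coordinate increments solve the same
  -- linear problem up to relative errors of order `κ`, so Grönwall keeps them close.
  have hf := norm_le_of_norm_deriv_le
    (f := fun s => (Z s y - Z s z) - ∑ i, (v i / ε) • (Z s (x + e i) - Z s x))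
    (f' := fun s => (F (Z s y) - F (Z s z)) - ∑ i, (v i / ε) • (F (Z s (x + e i)) - F (Z s x)))
    (T := T) (K := a) (ε := κ * L * (1 + N) * ‖v‖) (δ := κ * (1 + N) * ‖v‖) ha (by positivity)
    (fun s hs => (hZ.deriv_sub hz hy hs).sub
      (HasDerivWithinAt.fun_sum fun i _ => (hZ.deriv_sub hx (hxe i) hs).const_smul _))
    ?_ ?_ t ht
  · have h1 : π (Z t y) - π (Z t z) - G v =
        π ((Z t y - Z t z) - ∑ i, (v i / ε) • (Z t (x + e i) - Z t x))
        - (0 - ∑ i, (v i / ε) • (π (Z t (x + e i)) - π (Z t x) - G (e i))) := by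
      simp only [smul_sub (_ / _) (_ - _), Finset.sum_sub_distrib, hsumG, map_sub, map_sum, map_smul]
      abel
    have h2 := norm_sub_sum_smul_le v (c := κ) hε (0 : Conc N)
      (fun i => π (Z t (x + e i)) - π (Z t x) - G (e i)) (by simp; positivity) (fun i => by
        have := hGδ (show x + e i ∈ Metric.ball x δ₁ ∩ D from
          ⟨by rw [Metric.mem_ball, dist_eq_norm, add_sub_cancel_left, hne]; exact hεδ₁, hxe i⟩)
        simpa [hne] using this)
    rw [h1]
    refine (norm_sub_le _ _).trans ((add_le_add ((π.le_opNorm _).trans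
      (mul_le_mul_of_nonneg_left hf (norm_nonneg _))) h2).trans_eq ?_)
    have : κ * Q = η := by rw [hκdef]; field_simp
    rw [← this, hQ]
    ring
  · have h1 : (Z 0 y - Z 0 z) - ∑ i, (v i / ε) • (Z 0 (x + e i) - Z 0 x) =
        ((Z 0 y - Z 0 z) - fderiv ℝ z0 x v)
        - ∑ i, (v i / ε) • ((Z 0 (x + e i) - Z 0 x) - fderiv ℝ z0 x (e i)) := by
      simp only [smul_sub (_ / _) (_ - _), Finset.sum_sub_distrib, hsum0]
      abel
    rw [h1]
    refine norm_sub_sum_smul_le v hε _ _ (hlinκ y hy z hz hyx hzx).1 fun i => ?_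
    have := (hlinκ (x + e i) (hxe i) x hx (hei i) hxx).1
    rwa [add_sub_cancel_left, hne] at this
  · intro s hs
    set Φ := fderiv ℝ F (Z s x) with hΦ
    have h1 : (F (Z s y) - F (Z s z)) - ∑ i, (v i / ε) • (F (Z s (x + e i)) - F (Z s x)) =
        Φ ((Z s y - Z s z) - ∑ i, (v i / ε) • (Z s (x + e i) - Z s x)) +
        (((F (Z s y) - F (Z s z)) - Φ (Z s y - Z s z))
        - ∑ i, (v i / ε) • ((F (Z s (x + e i)) - F (Z s x)) - Φ (Z s (x + e i) - Z s x))) := by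
      rw [map_sub, map_sum]
      simp only [smul_sub (_ / _) (_ - _), Finset.sum_sub_distrib, map_smul]
      abel
    rw [h1]
    refine (norm_add_le _ _).trans (add_le_add ((Φ.le_opNorm _).trans
      (mul_le_mul_of_nonneg_right (hDF s hs) (norm_nonneg _))) ?_)
    refine norm_sub_sum_smul_le v hε _ _ ((hlinκ y hy z hz hyx hzx).2 s hs) fun i => ?_
    have := (hlinκ (x + e i) (hxe i) x hx (hei i) hxx).2 s hs
    rwa [add_sub_cancel_left, hne] at this

/-- If a component of the flow is injective with invertible differential, it is expansive up to a
constant, uniformly in time and for starting points in a compact set. -/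
theorem exists_antilipschitz (hF : ContDiff ℝ 1 F) (hz0 : ContDiff ℝ 1 z0) (hDc : IsClosed D)
    (hD : ∀ x ∈ D, ∀ i, ∀ ε : ℝ, 0 ≤ ε → x + ε • EuclideanSpace.single i (1 : ℝ) ∈ D)
    (hZ : IsTrajectoryFamily F D T z0 Z) (π : V →L[ℝ] Conc N)
    (hinj : ∀ t ∈ Icc 0 T, InjOn (fun y => π (Z t y)) D)
    (hinv : ∀ t ∈ Icc 0 T, ∀ x ∈ D,
      (fderivWithin ℝ (fun y => π (Z t y)) D x).IsInvertible)
    (hA : IsCompact A) (hAD : A ⊆ D) :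
    ∃ c > 0, ∀ t ∈ Icc 0 T, ∀ x ∈ A, ∀ y ∈ A, c * ‖y - x‖ ≤ ‖π (Z t y) - π (Z t x)‖ := by
  obtain ⟨B, L, hL, hB, hlip, htime, hdiff⟩ := hZ.exists_uniform_bounds hF hz0 hA hAD
  have hcomp : IsCompact (Icc 0 T ×ˢ (A ×ˢ A)) := isCompact_Icc.prod (hA.prod hA)
  suffices h : ∃ c > 0, ∀ q ∈ Icc 0 T ×ˢ (A ×ˢ A),
      c * ‖q.2.2 - q.2.1‖ ≤ ‖π (Z q.1 q.2.2) - π (Z q.1 q.2.1)‖ by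
    obtain ⟨c, hc, h⟩ := h
    exact ⟨c, hc, fun t ht x hx y hy => h (t, x, y) ⟨ht, hx, hy⟩⟩
  -- The bound passes to subsets and finite unions, so a neighbourhood of each `(t, x, y)` suffices:
  -- strict differentiability settles the diagonal, injectivity and continuity the rest.
  refine hcomp.induction_on (p := fun S => ∃ c > 0, ∀ q ∈ S,
    c * ‖q.2.2 - q.2.1‖ ≤ ‖π (Z q.1 q.2.2) - π (Z q.1 q.2.1)‖) ⟨1, one_pos, by simp⟩ ?_ ?_ ?_
  · rintro S S' hSS ⟨c, hc, h⟩
    exact ⟨c, hc, fun q hq => h q (hSS hq)⟩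
  · rintro S S' ⟨c, hc, h⟩ ⟨c', hc', h'⟩
    refine ⟨min c c', lt_min hc hc', fun q hq => hq.elim (fun hq => ?_) fun hq => ?_⟩
    · refine le_trans ?_ (h q hq)
      gcongr
      exact min_le_left _ _
    · refine le_trans ?_ (h' q hq)
      gcongr
      exact min_le_right _ _
  rintro ⟨t, x, y⟩ ⟨ht, hx, hy⟩
  by_cases hxy : x = y
  · subst hxy
    simp only at ht hx
    set G := fderivWithin ℝ (fun y => π (Z t y)) D x with hGdef
    obtain ⟨G', hG'⟩ := hinv t ht x (hAD hx)
    -- Differentiability is not assumed separately. Where it fails, `fderivWithin` is 0 by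
    -- convention; 0 is invertible only on a trivial space, where every map is differentiable.
    have hG : HasFDerivWithinAt (fun y => π (Z t y)) G D x := by
      by_cases hd : DifferentiableWithinAt ℝ (fun y => π (Z t y)) D x
      · exact hd.hasFDerivWithinAt
      · have h0 : G = 0 := fderivWithin_zero_of_not_differentiableWithinAt hd
        have hsub : Subsingleton (Conc N) := by
          refine ⟨fun a b => G'.injective ?_⟩
          have : (G' : Conc N →L[ℝ] Conc N) = 0 := hG'.trans h0
          have h1 : ∀ a, G' a = 0 := fun a => by
            simpa using congrArg (fun l : Conc N →L[ℝ] Conc N => l a) this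
          rw [h1, h1]
        rw [h0]
        exact hasFDerivWithinAt_of_subsingleton (fun y : Conc N => π (Z t y)) D x
    obtain ⟨a, ha, hGa⟩ : ∃ a > 0, ∀ v, a * ‖v‖ ≤ ‖G v‖ := by
      refine ⟨(‖(G'.symm : Conc N →L[ℝ] Conc N)‖ + 1)⁻¹, by positivity, fun v => ?_⟩
      rw [inv_mul_le_iff₀ (by positivity)]
      have h1 : G' v = G v := by
        simpa using congrArg (fun l : Conc N →L[ℝ] Conc N => l v) hG'
      have h2 := (G'.symm : Conc N →L[ℝ] Conc N).le_opNorm (G' v)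
      simp only [ContinuousLinearEquiv.coe_coe, ContinuousLinearEquiv.symm_apply_apply] at h2
      rw [h1] at h2
      nlinarith [norm_nonneg (G v)]
    obtain ⟨δ, hδ, hs⟩ := hZ.exists_strict_fderivWithin hF hz0 hDc hD π (hAD hx) ht hG
      (half_pos ha)
    -- Of the lower bound `a` for `G`, strict differentiability costs `a / 2` and moving from time
    -- `t` to a time within `τ` costs `a / 4`; a quarter remains.
    set τ := a / (4 * (‖π‖ * L + 1)) with hτ
    have hτpos : 0 < τ := by positivity
    refine ⟨(Icc 0 T ×ˢ (A ×ˢ A)) ∩ (Metric.ball t τ ×ˢ (Metric.ball x δ ×ˢ Metric.ball x δ)),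
      inter_mem_nhdsWithin _ (prod_mem_nhds (Metric.ball_mem_nhds _ hτpos)
        (prod_mem_nhds (Metric.ball_mem_nhds _ hδ) (Metric.ball_mem_nhds _ hδ))),
      a / 4, by positivity, ?_⟩
    rintro ⟨s, z, y⟩ ⟨⟨hsT, hz, hy⟩, hst, hzx, hyx⟩
    simp only [Metric.mem_ball, dist_eq_norm] at hst hzx hyx hsT hz hy
    rw [Real.norm_eq_abs] at hst
    have h1 := hs y (hAD hy) z (hAD hz) hyx hzx
    have h2 := (π.le_opNorm _).trans
      (mul_le_mul_of_nonneg_left (hdiff s hsT t ht z hz y hy) (norm_nonneg π))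
    have h3 := hGa (y - z)
    have h4 : ‖π‖ * (L * |s - t| * ‖y - z‖) ≤ a / 4 * ‖y - z‖ := by
      have : ‖π‖ * L * |s - t| ≤ a / 4 := by
        have h5 : (‖π‖ * L + 1) * |s - t| ≤ (‖π‖ * L + 1) * τ := by gcongr
        have h6 : (‖π‖ * L + 1) * τ = a / 4 := by rw [hτ]; field_simp
        nlinarith [abs_nonneg (s - t)]
      calc _ = ‖π‖ * L * |s - t| * ‖y - z‖ := by ring
        _ ≤ _ := by gcongr
    simp only [map_sub] at h2 ⊢
    have h7 : G (y - z) = (π (Z s y) - π (Z s z))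
        - ((π (Z s y) - π (Z s z)) - (π (Z t y) - π (Z t z)))
        - (π (Z t y) - π (Z t z) - G (y - z)) := by abel
    have h8 := norm_sub_le ((π (Z s y) - π (Z s z))
        - ((π (Z s y) - π (Z s z)) - (π (Z t y) - π (Z t z))))
        (π (Z t y) - π (Z t z) - G (y - z))
    rw [← h7] at h8
    have h9 := norm_sub_le (π (Z s y) - π (Z s z))
        ((π (Z s y) - π (Z s z)) - (π (Z t y) - π (Z t z)))
    linarith
  · simp only at ht hx hy
    have hcontX : ∀ x ∈ A, ∀ t ∈ Icc 0 T,
        ContinuousWithinAt (fun q : ℝ × Conc N => π (Z q.1 q.2)) (Icc 0 T ×ˢ A) (t, x) := by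
      intro x hx t ht
      refine π.continuous.continuousAt.comp_continuousWithinAt
        (f := fun q : ℝ × Conc N => Z q.1 q.2) ?_
      rw [ContinuousWithinAt, tendsto_iff_norm_sub_tendsto_zero]
      have hlim : Filter.Tendsto (fun q : ℝ × Conc N => L * |q.1 - t| + L * ‖q.2 - x‖)
          (nhdsWithin (t, x) (Icc 0 T ×ˢ A)) (nhds 0) := by
        have : Continuous (fun q : ℝ × Conc N => L * |q.1 - t| + L * ‖q.2 - x‖) := by fun_prop
        simpa using (this.tendsto (t, x)).mono_left nhdsWithin_le_nhds
      refine squeeze_zero' (Filter.Eventually.of_forall fun _ => norm_nonneg _) ?_ hlim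
      filter_upwards [self_mem_nhdsWithin] with q hq
      have h1 := htime q.1 hq.1 t ht q.2 hq.2
      have h2 := hlip t ht x hx q.2 hq.2
      have h3 : Z q.1 q.2 - Z t x = (Z q.1 q.2 - Z t q.2) + (Z t q.2 - Z t x) := by abel
      rw [h3]
      exact (norm_add_le _ _).trans (add_le_add h1 h2)
    have hg : ContinuousWithinAt
        (fun q : ℝ × Conc N × Conc N => ‖π (Z q.1 q.2.2) - π (Z q.1 q.2.1)‖)
        (Icc 0 T ×ˢ (A ×ˢ A)) (t, x, y) := by
      refine (ContinuousWithinAt.sub ?_ ?_).norm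
      · exact ContinuousWithinAt.comp (x := (t, x, y)) (g := fun q : ℝ × Conc N => π (Z q.1 q.2))
          (t := Icc 0 T ×ˢ A) (s := Icc 0 T ×ˢ (A ×ˢ A)) (hcontX y hy t ht)
          (f := fun q : ℝ × Conc N × Conc N => (q.1, q.2.2))
          (Continuous.continuousWithinAt (by fun_prop)) (fun q hq => ⟨hq.1, hq.2.2⟩)
      · exact ContinuousWithinAt.comp (x := (t, x, y)) (g := fun q : ℝ × Conc N => π (Z q.1 q.2))
          (t := Icc 0 T ×ˢ A) (s := Icc 0 T ×ˢ (A ×ˢ A)) (hcontX x hx t ht)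
          (f := fun q : ℝ × Conc N × Conc N => (q.1, q.2.1))
          (Continuous.continuousWithinAt (by fun_prop)) (fun q hq => ⟨hq.1, hq.2.1⟩)
    set g₀ := ‖π (Z t y) - π (Z t x)‖ with hg₀
    have hg₀pos : 0 < g₀ := by
      rw [hg₀, norm_pos_iff, sub_ne_zero]
      exact fun h => hxy (hinj t ht (hAD hx) (hAD hy) h.symm)
    obtain ⟨r, hr⟩ := hA.isBounded.subset_closedBall (0 : Conc N)
    have hev := hg.eventually (lt_mem_nhds (half_lt_self hg₀pos))
    have hr0 : 0 ≤ r := (norm_nonneg x).trans (mem_closedBall_zero_iff.1 (hr hx))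
    refine ⟨_, Filter.inter_mem hev self_mem_nhdsWithin, g₀ / 2 / (2 * r + 1), by positivity, ?_⟩
    rintro ⟨s, z, w⟩ ⟨hlt, hs, hz, hw⟩
    refine le_trans ?_ (le_of_lt hlt)
    have h1 : ‖w - z‖ ≤ 2 * r + 1 := by
      have h2 := norm_sub_le w z
      have h3 := mem_closedBall_zero_iff.1 (hr hz)
      have h4 := mem_closedBall_zero_iff.1 (hr hw)
      simp only at h3 h4
      linarith
    calc g₀ / 2 / (2 * r + 1) * ‖w - z‖ ≤ g₀ / 2 / (2 * r + 1) * (2 * r + 1) := by gcongr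
      _ = g₀ / 2 := by field_simp

end IsTrajectoryFamily

/-! ### The orthant and its mass sublevels -/

section Orthant

variable {N : ℕ}

theorem isClosed_orthant : IsClosed (orthant N) := by
  simp only [orthant, ofPred_forall]
  exact isClosed_iInter fun l => isClosed_le continuous_const (by fun_prop)

theorem convex_orthant : Convex ℝ (orthant N) := by
  intro x hx y hy a b ha hb _ l
  have h1 := mul_nonneg ha (hx l)
  have h2 := mul_nonneg hb (hy l)
  simpa using add_nonneg h1 h2

theorem interior_orthant_nonempty : (interior (orthant N)).Nonempty := by
  have hopen : IsOpen {x : Conc N | ∀ l, 0 < x l} := by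
    simp only [ofPred_forall]
    exact isOpen_iInter_of_finite fun l => isOpen_lt continuous_const (by fun_prop)
  refine ⟨WithLp.toLp 2 fun _ => 1, mem_interior.2 ⟨_, fun x hx l => (hx l).le, hopen, ?_⟩⟩
  intro l
  simp

theorem uniqueDiffOn_orthant : UniqueDiffOn ℝ (orthant N) :=
  uniqueDiffOn_convex convex_orthant interior_orthant_nonempty

/-- Permits difference quotients of the flow at boundary points. -/
theorem add_smul_single_mem_orthant {x : Conc N} (hx : x ∈ orthant N) (i : Fin N) {ε : ℝ}
    (hε : 0 ≤ ε) : x + ε • EuclideanSpace.single i (1 : ℝ) ∈ orthant N := by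
  intro l
  have : 0 ≤ (EuclideanSpace.single i (1 : ℝ) : Conc N) l := by
    by_cases h : l = i <;> simp [h]
  simpa using add_nonneg (hx l) (mul_nonneg hε this)

/-- The total mass `m · x`. -/
def totalMass (m : Fin N → ℝ) (x : Conc N) : ℝ := ∑ l, m l * x l

theorem continuous_totalMass (m : Fin N → ℝ) : Continuous (totalMass m) := by
  unfold totalMass
  fun_prop

theorem totalMass_eq_inner (m : Fin N → ℝ) (x : Conc N) :
    totalMass m x = inner ℝ (WithLp.toLp 2 m : Conc N) x := by
  simp [totalMass, PiLp.inner_apply, mul_comm]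

theorem totalMass_add_smul (m : Fin N → ℝ) (x v : Conc N) (s : ℝ) :
    totalMass m (x + s • v) = totalMass m x + s * totalMass m v := by
  simp only [totalMass_eq_inner, inner_add_right, inner_smul_right]

/-- The part of the orthant where the total mass is at most `K`. -/
def massSublevel (m : Fin N → ℝ) (K : ℝ) : Set (Conc N) := {x ∈ orthant N | totalMass m x ≤ K}

theorem massSublevel_subset_orthant (m : Fin N → ℝ) (K : ℝ) : massSublevel m K ⊆ orthant N :=
  fun _ h => h.1

theorem isClosed_massSublevel (m : Fin N → ℝ) (K : ℝ) : IsClosed (massSublevel m K) :=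
  isClosed_orthant.inter (isClosed_le (continuous_totalMass m) continuous_const)

theorem isCompact_massSublevel {m : Fin N → ℝ} (hm : ∀ l, 0 < m l) (K : ℝ) :
    IsCompact (massSublevel m K) := by
  refine Metric.isCompact_of_isClosed_isBounded (isClosed_massSublevel m K) ?_
  refine (Metric.isBounded_iff_subset_closedBall (0 : Conc N)).2 ⟨∑ l, K / m l, fun x hx => ?_⟩
  have hle : ∀ l, x l ≤ K / m l := by
    intro l
    rw [le_div_iff₀ (hm l), mul_comm]
    refine le_trans ?_ hx.2
    exact Finset.single_le_sum (f := fun l => m l * x l)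
      (fun i _ => mul_nonneg (hm i).le (hx.1 i)) (Finset.mem_univ l)
  rw [mem_closedBall_zero_iff]
  have h1 : x = ∑ l, (x l) • (EuclideanSpace.single l (1 : ℝ) : Conc N) := by
    ext j
    simp [Pi.single_apply]
  rw [h1]
  refine norm_sum_le_of_le _ fun l _ => ?_
  rw [norm_smul]
  simpa [abs_of_nonneg (hx.1 l)] using hle l

end Orthant

/-! ### The smooth Hamiltonian and its vector field -/

section Polynomial

variable {N : ℕ}

/-- The mass action polynomial `k ∏ x_ℓ^{a_ℓ}` on the whole space. -/
def massPoly (k : ℝ) (a : Fin N → ℕ) (x : Conc N) : ℝ := k * ∏ l, x l ^ a l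

theorem massAction_of_mem {k : ℝ} {a : Fin N → ℕ} {x : Conc N} (hx : x ∈ orthant N) :
    massAction k a x = massPoly k a x := indicator_of_mem hx _

theorem massAction_of_notMem {k : ℝ} {a : Fin N → ℕ} {x : Conc N} (hx : x ∉ orthant N) :
    massAction k a x = 0 := indicator_of_notMem hx _

theorem contDiff_massPoly (k : ℝ) (a : Fin N → ℕ) {n : ℕ∞} : ContDiff ℝ n (massPoly k a) := by
  unfold massPoly
  refine contDiff_const.mul (contDiff_prod fun l _ => ContDiff.pow ?_ _)
  fun_prop

end Polynomial

namespace ReactionNetwork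

variable {N M : ℕ} (R : ReactionNetwork N M)

theorem contDiff_nuDot (j : Fin M) {n : ℕ∞} : ContDiff ℝ n (R.nuDot j) := by
  unfold nuDot
  fun_prop

theorem nuDot_add_smul (j : Fin M) (p v : Conc N) (s : ℝ) :
    R.nuDot j (p + s • v) = R.nuDot j p + s * R.nuDot j v := by
  simp only [nuDot, Finset.mul_sum, ← Finset.sum_add_distrib]
  refine Finset.sum_congr rfl fun l _ => ?_
  simp
  ring

/-- The Hamiltonian as a smooth function of `(x, p)` on the whole space: the mass action
polynomials are not cut off outside the orthant. -/
def smoothHamiltonian (z : Conc N × Conc N) : ℝ :=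
  ∑ j, (massPoly (R.kPlus j) (R.nuPlus j) z.1 * (Real.exp (R.nuDot j z.2) - 1)
    + massPoly (R.kMinus j) (R.nuMinus j) z.1 * (Real.exp (-R.nuDot j z.2) - 1))

theorem contDiff_smoothHamiltonian {n : ℕ∞} : ContDiff ℝ n R.smoothHamiltonian := by
  unfold smoothHamiltonian
  refine ContDiff.sum fun j _ => ContDiff.add ?_ ?_
  · exact ((contDiff_massPoly _ _).comp contDiff_fst).mul
      ((((R.contDiff_nuDot j).comp contDiff_snd).exp).sub contDiff_const)
  · exact ((contDiff_massPoly _ _).comp contDiff_fst).mul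
      ((((R.contDiff_nuDot j).comp contDiff_snd).neg.exp).sub contDiff_const)

theorem hamiltonian_of_mem (p : Conc N) {x : Conc N} (hx : x ∈ orthant N) :
    R.hamiltonian p x = R.smoothHamiltonian (x, p) := by
  simp only [hamiltonian, smoothHamiltonian, PhiPlus, PhiMinus, massAction_of_mem hx]

/-- Only continuity of the rates matters: they vanish off the orthant and their zero sets are
closed. This freezes the solution on the boundary of the orthant. -/
theorem hamiltonian_of_mem_closure_compl (hLip : R.LocallyLipschitzRates) (p : Conc N)
    {x : Conc N} (hx : x ∈ closure (orthant N)ᶜ) : R.hamiltonian p x = 0 := by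
  have key : ∀ (k : ℝ) (a : Fin N → ℕ), LocallyLipschitz (massAction k a) →
      massAction k a x = 0 := by
    intro k a h
    have hcl : IsClosed {y : Conc N | massAction k a y = 0} :=
      isClosed_eq h.continuous continuous_const
    exact hcl.closure_subset_iff.2 (fun y hy => massAction_of_notMem hy) hx
  refine Finset.sum_eq_zero fun j _ => ?_
  rw [PhiPlus, PhiMinus, key _ _ (hLip j).1, key _ _ (hLip j).2]
  simp

theorem hamiltonian_of_notMem (p : Conc N) {x : Conc N} (hx : x ∉ orthant N) :
    R.hamiltonian p x = 0 := by
  simp [hamiltonian, PhiPlus, PhiMinus, massAction_of_notMem hx]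

/-- The `x`-gradient of the smooth Hamiltonian. -/
def gradX (z : Conc N × Conc N) : Conc N :=
  (InnerProductSpace.toDual ℝ (Conc N)).symm
    ((fderiv ℝ R.smoothHamiltonian z).comp (ContinuousLinearMap.inl ℝ (Conc N) (Conc N)))

/-- The `p`-gradient of the smooth Hamiltonian. -/
def gradP (z : Conc N × Conc N) : Conc N :=
  (InnerProductSpace.toDual ℝ (Conc N)).symm
    ((fderiv ℝ R.smoothHamiltonian z).comp (ContinuousLinearMap.inr ℝ (Conc N) (Conc N)))

theorem inner_gradX (z : Conc N × Conc N) (v : Conc N) :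
    inner ℝ (R.gradX z) v = fderiv ℝ R.smoothHamiltonian z (v, 0) := by
  simp [gradX]

theorem inner_gradP (z : Conc N × Conc N) (v : Conc N) :
    inner ℝ (R.gradP z) v = fderiv ℝ R.smoothHamiltonian z (0, v) := by
  simp [gradP]

theorem hasFDerivAt_smoothHamiltonian (z : Conc N × Conc N) :
    HasFDerivAt R.smoothHamiltonian (fderiv ℝ R.smoothHamiltonian z) z :=
  (R.contDiff_smoothHamiltonian (n := 1)).differentiable (by simp) z |>.hasFDerivAt

theorem hasGradientAt_snd (x p : Conc N) :
    HasGradientAt (fun p => R.smoothHamiltonian (x, p)) (R.gradP (x, p)) p := by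
  rw [hasGradientAt_iff_hasFDerivAt, gradP, LinearIsometryEquiv.apply_symm_apply]
  exact (R.hasFDerivAt_smoothHamiltonian (x, p)).comp p (hasFDerivAt_prodMk_right x p)

theorem hasGradientAt_fst (x p : Conc N) :
    HasGradientAt (fun x => R.smoothHamiltonian (x, p)) (R.gradX (x, p)) x := by
  rw [hasGradientAt_iff_hasFDerivAt, gradX, LinearIsometryEquiv.apply_symm_apply]
  exact (R.hasFDerivAt_smoothHamiltonian (x, p)).comp (f := fun x => (x, p)) x
    (hasFDerivAt_prodMk_left x p)

theorem contDiff_gradX : ContDiff ℝ 1 R.gradX := by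
  refine (InnerProductSpace.toDual ℝ (Conc N)).symm.contDiff.comp ?_
  exact ((R.contDiff_smoothHamiltonian (n := 2)).fderiv_right (m := 1) (by norm_num)).clm_comp
    contDiff_const

theorem contDiff_gradP : ContDiff ℝ 1 R.gradP := by
  refine (InnerProductSpace.toDual ℝ (Conc N)).symm.contDiff.comp ?_
  exact ((R.contDiff_smoothHamiltonian (n := 2)).fderiv_right (m := 1) (by norm_num)).clm_comp
    contDiff_const

/-- The vector field `(-∇_p H, ∇_x H)` of the bicharacteristics. -/
def charField (z : Conc N × Conc N) : Conc N × Conc N := (-R.gradP z, R.gradX z)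

theorem contDiff_charField : ContDiff ℝ 1 R.charField :=
  R.contDiff_gradP.neg.prodMk R.contDiff_gradX

theorem gradient_hamiltonian (p : Conc N) {x : Conc N} (hx : x ∈ orthant N) :
    gradient (fun p => R.hamiltonian p x) p = R.gradP (x, p) := by
  simp only [R.hamiltonian_of_mem _ hx]
  exact (R.hasGradientAt_snd x p).gradient

theorem _root_.HasGradientWithinAt.gradientWithin_eq {E : Type*} [NormedAddCommGroup E]
    [InnerProductSpace ℝ E] [CompleteSpace E] {f : E → ℝ} {s : Set E} {x g : E}
    (h : HasGradientWithinAt f g s x) (hs : UniqueDiffWithinAt ℝ s x) :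
    gradientWithin f s x = g := by
  rw [gradientWithin, HasFDerivWithinAt.fderivWithin h.hasFDerivWithinAt hs,
    LinearIsometryEquiv.symm_apply_apply]

theorem gradientWithin_hamiltonian (p : Conc N) {x : Conc N} (hx : x ∈ orthant N) :
    gradientWithin (fun x => R.hamiltonian p x) (orthant N) x = R.gradX (x, p) := by
  refine HasGradientWithinAt.gradientWithin_eq ?_ (uniqueDiffOn_orthant x hx)
  refine HasGradientWithinAt.congr (f := fun x => R.smoothHamiltonian (x, p))
    (HasFDerivAt.hasFDerivWithinAt (R.hasGradientAt_fst x p).hasFDerivAt)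
    (fun y hy => R.hamiltonian_of_mem p hy) (R.hamiltonian_of_mem p hx)

theorem gradX_zero_right (x : Conc N) : R.gradX (x, 0) = 0 := by
  have h : HasGradientAt (fun x : Conc N => R.smoothHamiltonian (x, 0)) 0 x := by
    have : (fun x : Conc N => R.smoothHamiltonian (x, 0)) = fun _ => 0 := by
      funext x
      simp [smoothHamiltonian, nuDot]
    rw [this]
    exact hasGradientAt_const x 0
  exact (R.hasGradientAt_fst x 0).unique h

theorem smoothHamiltonian_zero_right (x : Conc N) : R.smoothHamiltonian (x, 0) = 0 := by
  simp [smoothHamiltonian, nuDot]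

/-- The Hamiltonian is invariant under translation of the momentum along `m`, since it depends only
on the numbers `ν_j · p`. -/
theorem inner_gradP_mass {m : Fin N → ℝ} (hm : ∀ j, ∑ l, (R.nu j l : ℝ) * m l = 0)
    (z : Conc N × Conc N) : inner ℝ (WithLp.toLp 2 m : Conc N) (R.gradP z) = 0 := by
  rw [real_inner_comm, inner_gradP]
  set v : Conc N := WithLp.toLp 2 m
  have hv : ∀ j, R.nuDot j v = 0 := hm
  have h1 : HasDerivAt (fun s : ℝ => R.smoothHamiltonian (z.1, z.2 + s • v))
      (fderiv ℝ R.smoothHamiltonian z (0, v)) 0 := by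
    have h2 : HasDerivAt (fun s : ℝ => (z.1, z.2 + s • v)) ((0 : Conc N), v) 0 := by
      refine (hasDerivAt_const (0 : ℝ) z.1).prodMk ?_
      simpa using ((hasDerivAt_id (0 : ℝ)).smul_const v).const_add z.2
    have h4 : HasFDerivAt R.smoothHamiltonian (fderiv ℝ R.smoothHamiltonian z)
        (z.1, z.2 + (0 : ℝ) • v) := by
      simpa using R.hasFDerivAt_smoothHamiltonian z
    exact h4.comp_hasDerivAt 0 h2
  have h3 : (fun s : ℝ => R.smoothHamiltonian (z.1, z.2 + s • v)) =
      fun _ => R.smoothHamiltonian z := by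
    funext s
    simp [smoothHamiltonian, nuDot_add_smul, hv]
  rw [h3] at h1
  exact h1.unique (hasDerivAt_const _ _)

end ReactionNetwork

theorem eq_of_hasDerivWithinAt_zero {V : Type*} [NormedAddCommGroup V] [NormedSpace ℝ V]
    {f : ℝ → V} {T : ℝ} (hf : ∀ t ∈ Icc 0 T, HasDerivWithinAt f 0 (Icc 0 T) t) {t : ℝ}
    (ht : t ∈ Icc 0 T) : f t = f 0 := by
  have := (convex_Icc (0 : ℝ) T).norm_image_sub_le_of_norm_hasDerivWithin_le (C := 0) hf
    (fun _ _ => by simp) (⟨le_rfl, ht.1.trans ht.2⟩ : (0 : ℝ) ∈ Icc 0 T) ht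
  rw [zero_mul, norm_le_zero_iff] at this
  exact sub_eq_zero.1 this

theorem hasDerivWithinAt_integral {f : ℝ → ℝ} {T : ℝ} (hf : ContinuousOn f (Icc 0 T)) {t : ℝ}
    (ht : t ∈ Icc 0 T) :
    HasDerivWithinAt (fun s => ∫ τ in (0 : ℝ)..s, f τ) (f t) (Icc 0 T) t := by
  have : Fact (t ∈ Icc 0 T) := ⟨ht⟩
  refine intervalIntegral.integral_hasDerivWithinAt_right ?_
    (hf.stronglyMeasurableAtFilter_nhdsWithin measurableSet_Icc t) (hf t ht)
  refine ContinuousOn.intervalIntegrable (hf.mono ?_)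
  rw [uIcc_of_le ht.1]
  exact Icc_subset_Icc_right ht.2

theorem contDiff_gradient {E : Type*} [NormedAddCommGroup E] [InnerProductSpace ℝ E]
    [CompleteSpace E] {u : E → ℝ} (hu : ContDiff ℝ 2 u) : ContDiff ℝ 1 (gradient u) :=
  (InnerProductSpace.toDual ℝ E).symm.contDiff.comp (hu.fderiv_right (m := 1) (by norm_num))

/-! ### The action along bicharacteristics -/

namespace ReactionNetwork

variable {N M : ℕ} (R : ReactionNetwork N M)

/-- The Lagrangian `H - p · ∇_p H`, which is the rate of change of the solution along a
bicharacteristic. -/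
def lagrangian (z : Conc N × Conc N) : ℝ := R.smoothHamiltonian z - inner ℝ z.2 (R.gradP z)

/-- The action along the bicharacteristic that starts at `x`. -/
def action (u0 : Conc N → ℝ) (X P : ℝ → Conc N → Conc N) (t : ℝ) (x : Conc N) : ℝ :=
  u0 x + ∫ s in (0 : ℝ)..t, R.lagrangian (X s x, P s x)

/-- The starting point of the bicharacteristic that passes through `ξ` at time `t`. -/
def footPoint (X : ℝ → Conc N → Conc N) (t : ℝ) (ξ : Conc N) : Conc N :=
  Function.invFunOn (X t) (orthant N) ξ

/-- The solution given by the method of characteristics. -/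
def charSolution (u0 : Conc N → ℝ) (X P : ℝ → Conc N → Conc N) (t : ℝ) (ξ : Conc N) : ℝ :=
  R.action u0 X P t (footPoint X t ξ)

/-- The momentum transported to `ξ` at time `t`. -/
def charGradient (X P : ℝ → Conc N → Conc N) (t : ℝ) (ξ : Conc N) : Conc N :=
  P t (footPoint X t ξ)

theorem continuous_lagrangian : Continuous R.lagrangian := by
  unfold lagrangian
  exact (R.contDiff_smoothHamiltonian (n := 1)).continuous.sub
    (continuous_snd.inner R.contDiff_gradP.continuous)

namespace IsBicharacteristicFlow

variable {R} {u0 : Conc N → ℝ} {T : ℝ} {X P : ℝ → Conc N → Conc N} {m : Fin N → ℝ}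

theorem hasDeriv_x (hf : R.IsBicharacteristicFlow u0 T X P) {t : ℝ} (ht : t ∈ Icc 0 T)
    {x : Conc N} (hx : x ∈ orthant N) :
    HasDerivWithinAt (fun s => X s x) (-R.gradP (X t x, P t x)) (Icc 0 T) t := by
  rw [← R.gradient_hamiltonian _ (hf.mem t ht x hx)]
  exact hf.deriv_x t ht x hx

theorem hasDeriv_p (hf : R.IsBicharacteristicFlow u0 T X P) {t : ℝ} (ht : t ∈ Icc 0 T)
    {x : Conc N} (hx : x ∈ orthant N) :
    HasDerivWithinAt (fun s => P s x) (R.gradX (X t x, P t x)) (Icc 0 T) t := by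
  rw [← R.gradientWithin_hamiltonian _ (hf.mem t ht x hx)]
  exact hf.deriv_p t ht x hx

theorem isTrajectoryFamily (hf : R.IsBicharacteristicFlow u0 T X P) :
    IsTrajectoryFamily R.charField (orthant N) T (fun x => (x, gradient u0 x))
      (fun t x => (X t x, P t x)) where
  init x hx := by rw [hf.init_x x hx, hf.init_p x hx]
  deriv t ht x hx := (hf.hasDeriv_x ht hx).prodMk (hf.hasDeriv_p ht hx)

theorem totalMass_eq (hf : R.IsBicharacteristicFlow u0 T X P)
    (hm : ∀ j, ∑ l, (R.nu j l : ℝ) * m l = 0) {t : ℝ} (ht : t ∈ Icc 0 T) {x : Conc N}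
    (hx : x ∈ orthant N) : totalMass m (X t x) = totalMass m x := by
  have h := eq_of_hasDerivWithinAt_zero (f := fun s => totalMass m (X s x)) (T := T) ?_ ht
  · simpa only [hf.init_x x hx] using h
  · intro s hs
    simp only [totalMass_eq_inner]
    have := (hasDerivWithinAt_const s (Icc 0 T) (WithLp.toLp 2 m : Conc N)).inner ℝ
      (hf.hasDeriv_x hs hx)
    simpa [R.inner_gradP_mass hm] using this

/-- A bicharacteristic that starts with zero momentum keeps it. -/
theorem momentum_eq_zero (hf : R.IsBicharacteristicFlow u0 T X P) {x : Conc N}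
    (hx : x ∈ orthant N) (h0 : gradient u0 x = 0) {t : ℝ} (ht : t ∈ Icc 0 T) : P t x = 0 := by
  obtain ⟨r, hr⟩ := isCompact_Icc.exists_bound_of_continuousOn
    (hf.isTrajectoryFamily.continuousOn hx)
  -- Since `gradX` vanishes at zero momentum, the Lipschitz bound gives `‖P'‖ ≤ L * ‖P‖`.
  obtain ⟨L, hL, hlip⟩ := exists_lipschitz_closedBall R.contDiff_gradX r
  have := norm_le_of_norm_deriv_le (f := fun s => P s x) (ε := 0) (δ := 0) hL le_rfl
    (fun s hs => hf.hasDeriv_p hs hx) (by simp [hf.init_p x hx, h0]) (fun s hs => ?_) t ht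
  · simpa using this
  · have h1 := hr s hs
    have h2 := hlip (X s x, P s x) (by simpa using h1) (X s x, 0) (by
      rw [mem_closedBall_zero_iff, Prod.norm_mk]
      rw [Prod.norm_mk] at h1
      have := max_le_iff.1 h1
      simp [this.1])
    rw [R.gradX_zero_right, sub_zero] at h2
    simpa using h2

theorem hasDeriv_action (hf : R.IsBicharacteristicFlow u0 T X P) {x : Conc N}
    (hx : x ∈ orthant N) {t : ℝ} (ht : t ∈ Icc 0 T) :
    HasDerivWithinAt (fun s => R.action u0 X P s x) (R.lagrangian (X t x, P t x)) (Icc 0 T) t :=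
  (hasDerivWithinAt_integral (f := fun s => R.lagrangian (X s x, P s x))
    (R.continuous_lagrangian.comp_continuousOn (hf.isTrajectoryFamily.continuousOn hx)) ht).const_add
    _

theorem action_zero (x : Conc N) : R.action u0 X P 0 x = u0 x := by simp [action]

/-- Along neighbouring bicharacteristics the action is, to second order, the momentum paired with
the displacement. -/
theorem exists_action_bound (hf : R.IsBicharacteristicFlow u0 T X P) (hu0 : ContDiff ℝ 2 u0)
    (hT : 0 ≤ T) {A : Set (Conc N)} (hA : IsCompact A) (hAD : A ⊆ orthant N) :
    ∃ C : ℝ, 0 ≤ C ∧ ∀ t ∈ Icc 0 T, ∀ x ∈ A, ∀ y ∈ A,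
      |R.action u0 X P t y - R.action u0 X P t x - inner ℝ (P t x) (X t y - X t x)|
        ≤ C * ‖y - x‖ ^ 2 := by
  have hz0 : ContDiff ℝ 1 (fun x => (x, gradient u0 x)) :=
    contDiff_id.prodMk (contDiff_gradient hu0)
  obtain ⟨B, L, hL, hB, hlip, -, -⟩ :=
    hf.isTrajectoryFamily.exists_uniform_bounds R.contDiff_charField hz0 hA hAD
  obtain ⟨r, hr⟩ := hA.isBounded.subset_closedBall (0 : Conc N)
  obtain ⟨C₀, hC₀, hu⟩ := exists_taylor_two_closedBall hu0 r
  obtain ⟨C₁, hC₁, hH⟩ :=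
    exists_taylor_two_closedBall (R.contDiff_smoothHamiltonian (n := 2)) B
  obtain ⟨C₂, hC₂, hP⟩ := exists_lipschitz_closedBall R.contDiff_gradP B
  refine ⟨C₀ + (C₁ + C₂) * L ^ 2 * T, by positivity, fun t ht x hx y hy => ?_⟩
  have hxD := hAD hx
  have hyD := hAD hy
  have key := norm_le_of_norm_deriv_le
    (f := fun s => R.action u0 X P s y - R.action u0 X P s x - inner ℝ (P s x) (X s y - X s x))
    (f' := fun s => R.lagrangian (X s y, P s y) - R.lagrangian (X s x, P s x)
      - (inner ℝ (P s x) (-R.gradP (X s y, P s y) - -R.gradP (X s x, P s x))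
        + inner ℝ (R.gradX (X s x, P s x)) (X s y - X s x)))
    (T := T) (K := 0) (ε := (C₁ + C₂) * L ^ 2 * ‖y - x‖ ^ 2) (δ := C₀ * ‖y - x‖ ^ 2) le_rfl
    (by positivity)
    (fun s hs => ((hf.hasDeriv_action hyD hs).sub (hf.hasDeriv_action hxD hs)).sub
      ((hf.hasDeriv_p hs hxD).inner ℝ ((hf.hasDeriv_x hs hyD).sub (hf.hasDeriv_x hs hxD))))
    ?_ ?_ t ht
  · rw [Real.norm_eq_abs] at key
    refine key.trans_eq ?_
    rw [zero_mul, Real.exp_zero]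
    ring
  · simp only [action_zero, hf.init_x _ hxD, hf.init_x _ hyD, hf.init_p _ hxD]
    rw [inner_gradient_left]
    exact hu y (hr hy) x (hr hx)
  · intro s hs
    set zx := (X s x, P s x) with hzx
    set zy := (X s y, P s y) with hzy
    have hmx : zx ∈ Metric.closedBall (0 : Conc N × Conc N) B := by
      rw [mem_closedBall_zero_iff]; exact hB s hs x hx
    have hmy : zy ∈ Metric.closedBall (0 : Conc N × Conc N) B := by
      rw [mem_closedBall_zero_iff]; exact hB s hs y hy
    have h1 := hH zy hmy zx hmx
    have h2 := hP zx hmx zy hmy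
    have h3 : ‖zy - zx‖ ≤ L * ‖y - x‖ := hlip s hs x hx y hy
    have h4 : fderiv ℝ R.smoothHamiltonian zx (zy - zx) =
        inner ℝ (R.gradX zx) (X s y - X s x) + inner ℝ (R.gradP zx) (P s y - P s x) := by
      rw [inner_gradX, inner_gradP, ← map_add]
      simp [hzx, hzy]
    -- All first order terms cancel. What remains is the Taylor remainder of the Hamiltonian and a
    -- product of two differences, both quadratic in `zy - zx`.
    have h5 : R.lagrangian zy - R.lagrangian zx
        - (inner ℝ (P s x) (-R.gradP zy - -R.gradP zx)
          + inner ℝ (R.gradX zx) (X s y - X s x))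
        = (R.smoothHamiltonian zy - R.smoothHamiltonian zx
            - fderiv ℝ R.smoothHamiltonian zx (zy - zx))
          + inner ℝ (P s y - P s x) (R.gradP zx - R.gradP zy) := by
      rw [h4]
      simp only [lagrangian, inner_sub_left, inner_sub_right, inner_neg_right, hzx, hzy,
        real_inner_comm (P s y) (R.gradP (X s x, P s x)),
        real_inner_comm (P s x) (R.gradP (X s x, P s x))]
      ring
    have h6 : ‖P s y - P s x‖ ≤ ‖zy - zx‖ := norm_snd_le (zy - zx)
    rw [h5, zero_mul, zero_add]
    calc _ ≤ C₁ * ‖zy - zx‖ ^ 2 + ‖P s y - P s x‖ * ‖R.gradP zx - R.gradP zy‖ :=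
          (norm_add_le _ _).trans (add_le_add h1 (norm_inner_le_norm _ _))
      _ ≤ C₁ * ‖zy - zx‖ ^ 2 + ‖zy - zx‖ * (C₂ * ‖zy - zx‖) := by
          rw [norm_sub_rev zx zy] at h2
          gcongr
      _ = (C₁ + C₂) * ‖zy - zx‖ ^ 2 := by ring
      _ ≤ (C₁ + C₂) * (L * ‖y - x‖) ^ 2 := by gcongr
      _ = _ := by ring

end IsBicharacteristicFlow
end ReactionNetwork

/-! ### Regularity of the solution by characteristics -/

namespace ReactionNetwork

variable {N M : ℕ} {R : ReactionNetwork N M}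

section FootPoint

variable {X : ℝ → Conc N → Conc N} {t : ℝ} {x ξ : Conc N}

theorem footPoint_mem (hb : BijOn (X t) (orthant N) (orthant N)) (hξ : ξ ∈ orthant N) :
    footPoint X t ξ ∈ orthant N :=
  Function.invFunOn_mem (hb.surjOn hξ)

theorem flow_footPoint (hb : BijOn (X t) (orthant N) (orthant N)) (hξ : ξ ∈ orthant N) :
    X t (footPoint X t ξ) = ξ :=
  Function.invFunOn_eq (hb.surjOn hξ)

theorem footPoint_flow (hb : BijOn (X t) (orthant N) (orthant N)) (hx : x ∈ orthant N) :
    footPoint X t (X t x) = x :=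
  hb.injOn.leftInvOn_invFunOn hx

end FootPoint

namespace IsBicharacteristicFlow

variable {u0 : Conc N → ℝ} {T : ℝ} {X P : ℝ → Conc N → Conc N} {m : Fin N → ℝ}

theorem footPoint_mem_massSublevel (hf : R.IsBicharacteristicFlow u0 T X P)
    (hm : ∀ j, ∑ l, (R.nu j l : ℝ) * m l = 0) {t : ℝ} (ht : t ∈ Icc 0 T)
    (hb : BijOn (X t) (orthant N) (orthant N)) {K : ℝ} {ξ : Conc N} (hξ : ξ ∈ massSublevel m K) :
    footPoint X t ξ ∈ massSublevel m K := by
  refine ⟨footPoint_mem hb hξ.1, ?_⟩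
  rw [← hf.totalMass_eq hm ht (footPoint_mem hb hξ.1), flow_footPoint hb hξ.1]
  exact hξ.2

/-- On a mass sublevel the solution by characteristics has a second order Taylor expansion in
space, and its gradient is Lipschitz in space and time, uniformly. -/
theorem exists_charSolution_bounds (hf : R.IsBicharacteristicFlow u0 T X P)
    (hu0 : ContDiff ℝ 2 u0) (hT : 0 ≤ T)
    (hbi : ∀ t ∈ Icc 0 T, BijOn (X t) (orthant N) (orthant N) ∧
      ∀ x₀ ∈ orthant N, (fderivWithin ℝ (X t) (orthant N) x₀).IsInvertible)
    (hmpos : ∀ l, 0 < m l) (hm : ∀ j, ∑ l, (R.nu j l : ℝ) * m l = 0) (K : ℝ) :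
    ∃ C : ℝ, 0 ≤ C ∧
      (∀ t ∈ Icc 0 T, ∀ ξ ∈ massSublevel m K, ‖charGradient X P t ξ‖ ≤ C) ∧
      (∀ t ∈ Icc 0 T, ∀ ξ ∈ massSublevel m K, ∀ η ∈ massSublevel m K,
        |R.charSolution u0 X P t η - R.charSolution u0 X P t ξ
          - inner ℝ (charGradient X P t ξ) (η - ξ)| ≤ C * ‖η - ξ‖ ^ 2) ∧
      (∀ t ∈ Icc 0 T, ∀ s ∈ Icc 0 T, ∀ ξ ∈ massSublevel m K, ∀ η ∈ massSublevel m K,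
        ‖charGradient X P t ξ - charGradient X P s η‖ ≤ C * (|t - s| + ‖ξ - η‖)) := by
  have hz0 : ContDiff ℝ 1 (fun x => (x, gradient u0 x)) :=
    contDiff_id.prodMk (contDiff_gradient hu0)
  have hA := isCompact_massSublevel hmpos K
  have hAD := massSublevel_subset_orthant m K
  obtain ⟨B, L, hL, hB, hlip, htime, -⟩ :=
    hf.isTrajectoryFamily.exists_uniform_bounds R.contDiff_charField hz0 hA hAD
  obtain ⟨C₁, hC₁, hact⟩ := hf.exists_action_bound hu0 hT hA hAD
  obtain ⟨c, hc, hanti⟩ := hf.isTrajectoryFamily.exists_antilipschitz R.contDiff_charField hz0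
    isClosed_orthant (fun x hx i ε hε => add_smul_single_mem_orthant hx i hε)
    (ContinuousLinearMap.fst ℝ (Conc N) (Conc N)) (fun t ht => (hbi t ht).1.injOn)
    (fun t ht => (hbi t ht).2) hA hAD
  simp only [ContinuousLinearMap.coe_fst'] at hanti
  have hfoot : ∀ t ∈ Icc 0 T, ∀ ξ ∈ massSublevel m K, footPoint X t ξ ∈ massSublevel m K :=
    fun t ht ξ hξ => hf.footPoint_mem_massSublevel hm ht (hbi t ht).1 hξ
  have hX : ∀ t ∈ Icc 0 T, ∀ ξ ∈ massSublevel m K, X t (footPoint X t ξ) = ξ :=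
    fun t ht ξ hξ => flow_footPoint (hbi t ht).1 hξ.1
  have hB' : ∀ t ∈ Icc 0 T, ∀ ξ ∈ massSublevel m K, ‖charGradient X P t ξ‖ ≤ |B| :=
    fun t ht ξ hξ => (norm_snd_le (X t (footPoint X t ξ), P t (footPoint X t ξ))).trans
      ((hB t ht _ (hfoot t ht ξ hξ)).trans (le_abs_self B))
  set C := |B| + C₁ / c ^ 2 + (L + L / c * (L + 1)) with hC
  have hC0 : 0 ≤ C := by positivity
  have hn1 : 0 ≤ C₁ / c ^ 2 := by positivity
  have hn2 : 0 ≤ L + L / c * (L + 1) := by positivity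
  refine ⟨C, hC0, fun t ht ξ hξ => (hB' t ht ξ hξ).trans (by linarith),
    fun t ht ξ hξ η hη => ?_, fun t ht s hs ξ hξ η hη => ?_⟩
  · have h1 := hact t ht _ (hfoot t ht ξ hξ) _ (hfoot t ht η hη)
    have h2 := hanti t ht _ (hfoot t ht ξ hξ) _ (hfoot t ht η hη)
    rw [hX t ht ξ hξ, hX t ht η hη] at h1 h2
    refine h1.trans ?_
    -- Expansiveness of the flow turns an error quadratic in the foot points into one quadratic in
    -- the endpoints.
    have h3 : ‖footPoint X t η - footPoint X t ξ‖ ≤ ‖η - ξ‖ / c := by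
      rw [le_div_iff₀ hc, mul_comm]; exact h2
    calc C₁ * ‖footPoint X t η - footPoint X t ξ‖ ^ 2 ≤ C₁ * (‖η - ξ‖ / c) ^ 2 := by gcongr
      _ = C₁ / c ^ 2 * ‖η - ξ‖ ^ 2 := by ring
      _ ≤ C * ‖η - ξ‖ ^ 2 := by
        gcongr
        linarith [abs_nonneg B]
  · set x := footPoint X t ξ with hx
    set y := footPoint X s η with hy
    have hxA := hfoot t ht ξ hξ
    have hyA := hfoot s hs η hη
    have h1 := hanti s hs y hyA x hxA
    have h2 : ‖X t x - X s x‖ ≤ L * |t - s| :=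
      (norm_fst_le ((X t x, P t x) - (X s x, P s x))).trans (htime t ht s hs x hxA)
    have h3 : ‖P t x - P s x‖ ≤ L * |t - s| :=
      (norm_snd_le ((X t x, P t x) - (X s x, P s x))).trans (htime t ht s hs x hxA)
    have h4 : ‖P s x - P s y‖ ≤ L * ‖x - y‖ :=
      (norm_snd_le ((X s x, P s x) - (X s y, P s y))).trans (hlip s hs y hyA x hxA)
    -- Both foot points are flowed to the same time `s`, when `y` is at `η` and `x` is within `L *
    -- |t - s|` of `ξ`.
    have h5 : ‖x - y‖ ≤ (L * |t - s| + ‖ξ - η‖) / c := by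
      rw [le_div_iff₀ hc, mul_comm]
      refine h1.trans ?_
      have e : X s x - X s y = -(X t x - X s x) + (ξ - η) := by
        rw [hX t ht ξ hξ, hX s hs η hη]; abel
      rw [e]
      refine (norm_add_le _ _).trans ?_
      rw [norm_neg]
      gcongr
    have h6 : charGradient X P t ξ - charGradient X P s η
        = (P t x - P s x) + (P s x - P s y) := by
      simp [charGradient, hx, hy]
    rw [h6]
    calc _ ≤ L * |t - s| + L * ((L * |t - s| + ‖ξ - η‖) / c) := by
          refine (norm_add_le _ _).trans (add_le_add h3 (h4.trans ?_))
          gcongr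
      _ ≤ (L + L / c * (L + 1)) * (|t - s| + ‖ξ - η‖) := by
          have e1 : 0 ≤ L * ‖ξ - η‖ := by positivity
          have e2 : 0 ≤ L / c * |t - s| := by positivity
          have e3 : 0 ≤ L / c * L * ‖ξ - η‖ := by positivity
          have e4 : L * ((L * |t - s| + ‖ξ - η‖) / c)
            = L / c * L * |t - s| + L / c * ‖ξ - η‖ := by ring
          nlinarith
      _ ≤ C * (|t - s| + ‖ξ - η‖) := by
          gcongr
          linarith [abs_nonneg B]

/-- The solution by characteristics satisfies the equation. -/
theorem hasDeriv_charSolution (hf : R.IsBicharacteristicFlow u0 T X P)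
    (hu0 : ContDiff ℝ 2 u0)
    (hbi : ∀ t ∈ Icc 0 T, BijOn (X t) (orthant N) (orthant N) ∧
      ∀ x₀ ∈ orthant N, (fderivWithin ℝ (X t) (orthant N) x₀).IsInvertible)
    (hmpos : ∀ l, 0 < m l) (hm : ∀ j, ∑ l, (R.nu j l : ℝ) * m l = 0)
    {t : ℝ} (ht : t ∈ Icc 0 T) {ξ : Conc N} (hξ : ξ ∈ orthant N) :
    HasDerivWithinAt (fun s => R.charSolution u0 X P s ξ)
      (R.smoothHamiltonian (ξ, charGradient X P t ξ)) (Icc 0 T) t := by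
  set K := totalMass m ξ with hK
  have hξK : ξ ∈ massSublevel m K := ⟨hξ, le_rfl⟩
  obtain ⟨C, hC, -, htay, -⟩ :=
    hf.exists_charSolution_bounds hu0 (ht.1.trans ht.2) hbi hmpos hm K
  set x := footPoint X t ξ with hx
  have hxD : x ∈ orthant N := footPoint_mem (hbi t ht).1 hξ
  have hXx : X t x = ξ := flow_footPoint (hbi t ht).1 hξ
  have hXK : ∀ s ∈ Icc 0 T, X s x ∈ massSublevel m K := fun s hs =>
    ⟨hf.mem s hs x hxD, by
      rw [hf.totalMass_eq hm hs hxD, ← hf.totalMass_eq hm ht hxD, hXx]⟩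
  -- The first order expansion about the moving point `X s x`, evaluated at the fixed point `ξ`. At
  -- `s = t` the term `⟨p, ∇_p H⟩` cancels that of the Lagrangian and leaves `H`.
  set f : ℝ → ℝ := fun s => R.action u0 X P s x + inner ℝ (P s x) (ξ - X s x) with hfdef
  have hf' : HasDerivWithinAt f (R.smoothHamiltonian (ξ, charGradient X P t ξ)) (Icc 0 T) t := by
    have h1 := (hf.hasDeriv_action hxD ht).add
      ((hf.hasDeriv_p ht hxD).inner ℝ ((hf.hasDeriv_x ht hxD).const_sub ξ))
    refine h1.congr_deriv ?_
    simp [hXx, lagrangian, charGradient, ← hx]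
  -- The Taylor remainder is quadratic in `ξ - X s x`, hence quadratic in `s - t`.
  have hg : HasDerivWithinAt (fun s => R.charSolution u0 X P s ξ - f s) 0 (Icc 0 T) t := by
    have hbig : (fun s => R.charSolution u0 X P s ξ - f s)
        =O[nhdsWithin t (Icc 0 T)] fun s => ‖s - t‖ ^ 2 := by
      have hXO : (fun s => X s x - X t x) =O[nhdsWithin t (Icc 0 T)] fun s => s - t :=
        (hf.hasDeriv_x ht hxD).hasFDerivWithinAt.isBigO_sub
      have hX2 : (fun s => ‖X s x - X t x‖ ^ 2) =O[nhdsWithin t (Icc 0 T)]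
          fun s => ‖s - t‖ ^ 2 := hXO.norm_norm.pow 2
      refine Asymptotics.IsBigO.trans (Asymptotics.IsBigO.of_bound C ?_) hX2
      filter_upwards [self_mem_nhdsWithin] with s hs
      have h1 := htay s hs _ (hXK s hs) ξ hξK
      have h2 : footPoint X s (X s x) = x := footPoint_flow (hbi s hs).1 hxD
      simp only [charGradient, charSolution, h2] at h1
      rw [norm_pow, norm_norm, norm_sub_rev (X s x), hXx, Real.norm_eq_abs]
      convert h1 using 2
      simp only [hfdef, charSolution]
      ring
    have h3 := (hbig.hasFDerivWithinAt (𝕜 := ℝ) ht (by norm_num)).hasDerivWithinAt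
    simpa using h3
  refine ((hg.add hf').congr_deriv (zero_add _)).congr_of_mem (fun s _ => ?_) ht
  simp

theorem charSolution_zero (hf : R.IsBicharacteristicFlow u0 T X P)
    (hb : BijOn (X 0) (orthant N) (orthant N)) {ξ : Conc N} (hξ : ξ ∈ orthant N) :
    R.charSolution u0 X P 0 ξ = u0 ξ := by
  have h1 : footPoint X 0 ξ = ξ := by
    rw [← hf.init_x _ (footPoint_mem hb hξ), flow_footPoint hb hξ]
  rw [charSolution, action_zero, h1]

end IsBicharacteristicFlow
end ReactionNetwork

/-! ### Joint differentiability and behaviour at large mass -/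

namespace ReactionNetwork

variable {N M : ℕ} {R : ReactionNetwork N M}

namespace IsBicharacteristicFlow

variable {u0 : Conc N → ℝ} {T : ℝ} {X P : ℝ → Conc N → Conc N} {m : Fin N → ℝ}

/-- Raising the mass bound by 1 makes the sublevel a relative neighbourhood, so that its uniform
constants give local statements. -/
theorem massSublevel_mem_nhdsWithin (m : Fin N → ℝ) (t : ℝ) (ξ : Conc N) :
    Icc 0 T ×ˢ massSublevel m (totalMass m ξ + 1) ∈ nhdsWithin (t, ξ) (Icc 0 T ×ˢ orthant N) := by
  have hopen : IsOpen {q : ℝ × Conc N | totalMass m q.2 < totalMass m ξ + 1} :=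
    isOpen_lt ((continuous_totalMass m).comp continuous_snd) continuous_const
  filter_upwards [self_mem_nhdsWithin,
    mem_nhdsWithin_of_mem_nhds (hopen.mem_nhds (show (t, ξ) ∈ _ by simp))] with q hq hq'
  exact ⟨hq.1, hq.2, le_of_lt hq'⟩

theorem continuousOn_charGradient (hf : R.IsBicharacteristicFlow u0 T X P)
    (hu0 : ContDiff ℝ 2 u0) (hT : 0 ≤ T)
    (hbi : ∀ t ∈ Icc 0 T, BijOn (X t) (orthant N) (orthant N) ∧
      ∀ x₀ ∈ orthant N, (fderivWithin ℝ (X t) (orthant N) x₀).IsInvertible)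
    (hmpos : ∀ l, 0 < m l) (hm : ∀ j, ∑ l, (R.nu j l : ℝ) * m l = 0) :
    ContinuousOn (fun q : ℝ × Conc N => charGradient X P q.1 q.2) (Icc 0 T ×ˢ orthant N) := by
  rintro ⟨t, ξ⟩ ⟨ht, hξ⟩
  simp only at ht hξ
  obtain ⟨C, hC, -, -, hlip⟩ :=
    hf.exists_charSolution_bounds hu0 hT hbi hmpos hm (totalMass m ξ + 1)
  rw [ContinuousWithinAt, tendsto_iff_norm_sub_tendsto_zero]
  have hlim : Filter.Tendsto (fun q : ℝ × Conc N => C * (|q.1 - t| + ‖q.2 - ξ‖))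
      (nhdsWithin (t, ξ) (Icc 0 T ×ˢ orthant N)) (nhds 0) := by
    have : Continuous (fun q : ℝ × Conc N => C * (|q.1 - t| + ‖q.2 - ξ‖)) := by fun_prop
    simpa using (this.tendsto (t, ξ)).mono_left nhdsWithin_le_nhds
  refine squeeze_zero' (Filter.Eventually.of_forall fun _ => norm_nonneg _) ?_ hlim
  filter_upwards [massSublevel_mem_nhdsWithin m t ξ] with q hq
  exact hlip q.1 hq.1 t ht q.2 hq.2 ξ ⟨hξ, by linarith⟩

/-- The increment splits into the variation in time at `ξ` and the spatial expansion at the new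
time. Replacing the new slope by the old one costs a product of a time and a space increment, which
is again quadratic. -/
theorem hasFDerivWithinAt_charSolution (hf : R.IsBicharacteristicFlow u0 T X P)
    (hu0 : ContDiff ℝ 2 u0) (hT : 0 ≤ T)
    (hbi : ∀ t ∈ Icc 0 T, BijOn (X t) (orthant N) (orthant N) ∧
      ∀ x₀ ∈ orthant N, (fderivWithin ℝ (X t) (orthant N) x₀).IsInvertible)
    (hmpos : ∀ l, 0 < m l) (hm : ∀ j, ∑ l, (R.nu j l : ℝ) * m l = 0)
    {t : ℝ} (ht : t ∈ Icc 0 T) {ξ : Conc N} (hξ : ξ ∈ orthant N) :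
    HasFDerivWithinAt (fun q : ℝ × Conc N => R.charSolution u0 X P q.1 q.2)
      (R.smoothHamiltonian (ξ, charGradient X P t ξ) • ContinuousLinearMap.fst ℝ ℝ (Conc N)
        + (innerSL ℝ (charGradient X P t ξ)).comp (ContinuousLinearMap.snd ℝ ℝ (Conc N)))
      (Icc 0 T ×ˢ orthant N) (t, ξ) := by
  obtain ⟨C, hC, -, htay, hlip⟩ :=
    hf.exists_charSolution_bounds hu0 hT hbi hmpos hm (totalMass m ξ + 1)
  have hξK : ξ ∈ massSublevel m (totalMass m ξ + 1) := ⟨hξ, by linarith⟩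
  set p := charGradient X P t ξ with hp
  have h1 : HasFDerivWithinAt (fun q : ℝ × Conc N => R.charSolution u0 X P q.1 ξ)
      (R.smoothHamiltonian (ξ, p) • ContinuousLinearMap.fst ℝ ℝ (Conc N))
      (Icc 0 T ×ˢ orthant N) (t, ξ) := by
    have hfst : HasFDerivWithinAt (fun q : ℝ × Conc N => q.1)
        (ContinuousLinearMap.fst ℝ ℝ (Conc N)) (Icc 0 T ×ˢ orthant N) (t, ξ) :=
      hasFDerivWithinAt_fst
    exact (hf.hasDeriv_charSolution hu0 hbi hmpos hm ht hξ).comp_hasFDerivWithinAt (t, ξ) hfst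
      (fun q hq => hq.1)
  have h2 : HasFDerivWithinAt (fun q : ℝ × Conc N => inner ℝ p (q.2 - ξ))
      ((innerSL ℝ p).comp (ContinuousLinearMap.snd ℝ ℝ (Conc N)))
      (Icc 0 T ×ˢ orthant N) (t, ξ) := by
    have hsnd : HasFDerivWithinAt (fun q : ℝ × Conc N => q.2 - ξ)
        (ContinuousLinearMap.snd ℝ ℝ (Conc N)) (Icc 0 T ×ˢ orthant N) (t, ξ) :=
      hasFDerivWithinAt_snd.sub_const ξ
    exact (innerSL ℝ p).hasFDerivAt.comp_hasFDerivWithinAt (t, ξ) hsnd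
  have h3 : HasFDerivWithinAt (fun q : ℝ × Conc N => R.charSolution u0 X P q.1 q.2
      - (R.charSolution u0 X P q.1 ξ + inner ℝ p (q.2 - ξ))) (0 : ℝ × Conc N →L[ℝ] ℝ)
      (Icc 0 T ×ˢ orthant N) (t, ξ) := by
    refine Asymptotics.IsBigO.hasFDerivWithinAt (n := 2) (Asymptotics.IsBigO.of_bound (2 * C) ?_)
      ⟨ht, hξ⟩ (by norm_num)
    filter_upwards [massSublevel_mem_nhdsWithin m t ξ] with q hq
    have e1 := htay q.1 hq.1 ξ hξK q.2 hq.2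
    have e2 := hlip q.1 hq.1 t ht ξ hξK ξ hξK
    rw [sub_self, norm_zero, add_zero, ← hp] at e2
    have e3 : ‖q.2 - ξ‖ ≤ ‖q - (t, ξ)‖ := norm_snd_le (q - (t, ξ))
    have e4 : |q.1 - t| ≤ ‖q - (t, ξ)‖ := norm_fst_le (q - (t, ξ))
    have e5 : R.charSolution u0 X P q.1 q.2
        - (R.charSolution u0 X P q.1 ξ + inner ℝ p (q.2 - ξ))
        = (R.charSolution u0 X P q.1 q.2 - R.charSolution u0 X P q.1 ξ
          - inner ℝ (charGradient X P q.1 ξ) (q.2 - ξ))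
          + inner ℝ (charGradient X P q.1 ξ - p) (q.2 - ξ) := by
      rw [inner_sub_left]; ring
    rw [e5, norm_pow, norm_norm]
    calc _ ≤ C * ‖q.2 - ξ‖ ^ 2 + C * |q.1 - t| * ‖q.2 - ξ‖ := by
          refine (norm_add_le _ _).trans (add_le_add e1 ((norm_inner_le_norm _ _).trans ?_))
          gcongr
      _ ≤ C * ‖q - (t, ξ)‖ ^ 2 + C * ‖q - (t, ξ)‖ * ‖q - (t, ξ)‖ := by gcongr
      _ = 2 * C * ‖q - (t, ξ)‖ ^ 2 := by ring
  refine HasFDerivWithinAt.congr' ((h3.add (h1.add h2)).congr_fderiv (zero_add _))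
    (fun q _ => ?_) ⟨ht, hξ⟩
  simp

theorem contDiffOn_charSolution (hf : R.IsBicharacteristicFlow u0 T X P)
    (hu0 : ContDiff ℝ 2 u0) (hT : 0 < T)
    (hbi : ∀ t ∈ Icc 0 T, BijOn (X t) (orthant N) (orthant N) ∧
      ∀ x₀ ∈ orthant N, (fderivWithin ℝ (X t) (orthant N) x₀).IsInvertible)
    (hmpos : ∀ l, 0 < m l) (hm : ∀ j, ∑ l, (R.nu j l : ℝ) * m l = 0) :
    ContDiffOn ℝ 1 (fun q : ℝ × Conc N => R.charSolution u0 X P q.1 q.2)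
      (Icc 0 T ×ˢ orthant N) := by
  rw [← zero_add (1 : WithTop ℕ∞), contDiffOn_succ_iff_hasFDerivWithinAt_of_uniqueDiffOn
    ((uniqueDiffOn_Icc hT).prod uniqueDiffOn_orthant)]
  refine ⟨by simp, _, ?_, fun q hq =>
    hf.hasFDerivWithinAt_charSolution hu0 hT.le hbi hmpos hm hq.1 hq.2⟩
  rw [contDiffOn_zero]
  have hq := hf.continuousOn_charGradient hu0 hT.le hbi hmpos hm
  refine ContinuousOn.fun_add (ContinuousOn.fun_smul ?_ continuousOn_const) ?_
  · exact (R.contDiff_smoothHamiltonian (n := 1)).continuous.comp_continuousOn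
      (continuousOn_snd.prodMk hq)
  · exact ((innerSL ℝ).continuous.comp_continuousOn hq).clm_comp continuousOn_const

theorem hasGradientWithinAt_charSolution (hf : R.IsBicharacteristicFlow u0 T X P)
    (hu0 : ContDiff ℝ 2 u0) (hT : 0 ≤ T)
    (hbi : ∀ t ∈ Icc 0 T, BijOn (X t) (orthant N) (orthant N) ∧
      ∀ x₀ ∈ orthant N, (fderivWithin ℝ (X t) (orthant N) x₀).IsInvertible)
    (hmpos : ∀ l, 0 < m l) (hm : ∀ j, ∑ l, (R.nu j l : ℝ) * m l = 0)
    {t : ℝ} (ht : t ∈ Icc 0 T) {ξ : Conc N} (hξ : ξ ∈ orthant N) :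
    HasGradientWithinAt (R.charSolution u0 X P t) (charGradient X P t ξ) (orthant N) ξ := by
  rw [hasGradientWithinAt_iff_hasFDerivWithinAt]
  have := (hf.hasFDerivWithinAt_charSolution hu0 hT hbi hmpos hm ht hξ).comp ξ
    (hasFDerivAt_prodMk_right t ξ).hasFDerivWithinAt (s := orthant N) (fun η hη => ⟨ht, hη⟩)
  refine this.congr_fderiv ?_
  ext v
  simp

/-- For large total mass the solution is constant. -/
theorem exists_const_of_large_mass (hf : R.IsBicharacteristicFlow u0 T X P)
    (hu0 : ContDiff ℝ 2 u0) (hu0c : ConstAtInfinity u0)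
    (hbi : ∀ t ∈ Icc 0 T, BijOn (X t) (orthant N) (orthant N))
    (hm : ∀ j, ∑ l, (R.nu j l : ℝ) * m l = 0) :
    ∃ K c : ℝ, ∀ t ∈ Icc 0 T, ∀ ξ ∈ orthant N, K < totalMass m ξ →
      R.charSolution u0 X P t ξ = c ∧ charGradient X P t ξ = 0 := by
  obtain ⟨r, c, hrc⟩ := hu0c
  -- By Cauchy–Schwarz a point of mass above `K` has norm above `r`.
  set K := ‖(WithLp.toLp 2 m : Conc N)‖ * |r| with hK
  refine ⟨K, c, fun t ht ξ hξ hlt => ?_⟩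
  set x := footPoint X t ξ with hx
  have hxD : x ∈ orthant N := footPoint_mem (hbi t ht) hξ
  have hxK : K < totalMass m x := by
    rw [← hf.totalMass_eq hm ht hxD, flow_footPoint (hbi t ht) hξ]
    exact hlt
  have hxr : r < ‖x‖ := by
    by_contra! h
    rw [totalMass_eq_inner] at hxK
    have h1 := real_inner_le_norm (WithLp.toLp 2 m : Conc N) x
    have h2 : ‖(WithLp.toLp 2 m : Conc N)‖ * ‖x‖ ≤ K := by
      rw [hK]
      gcongr
      exact h.trans (le_abs_self r)
    linarith
  -- The foot point may lie on the boundary and `u0` is constant only inside the orthant; the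
  -- one-sided gradient decides, by unique differentiability.
  have hgrad : gradient u0 x = 0 := by
    have h1 : HasGradientWithinAt u0 (gradient u0 x) (orthant N) x :=
      (hu0.differentiable two_ne_zero x).hasGradientAt.hasFDerivAt.hasFDerivWithinAt
    have h2 : HasGradientWithinAt u0 0 (orthant N) x := by
      refine (hasGradientWithinAt_const x _ c).congr_of_eventuallyEq ?_ (hrc x hxD hxr.le)
      have hopen : IsOpen {y : Conc N | r < ‖y‖} := isOpen_lt continuous_const continuous_norm
      filter_upwards [self_mem_nhdsWithin, mem_nhdsWithin_of_mem_nhds (hopen.mem_nhds hxr)]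
        with y hy hy'
      exact hrc y hy (le_of_lt hy')
    rw [← h1.gradientWithin_eq (uniqueDiffOn_orthant x hxD),
      h2.gradientWithin_eq (uniqueDiffOn_orthant x hxD)]
  have hP : ∀ s ∈ Icc 0 T, P s x = 0 := fun s hs => hf.momentum_eq_zero hxD hgrad hs
  refine ⟨?_, hP t ht⟩
  have h0 : ∫ s in (0 : ℝ)..t, R.lagrangian (X s x, P s x) = ∫ s in (0 : ℝ)..t, (0 : ℝ) := by
    refine intervalIntegral.integral_congr fun s hs => ?_
    rw [uIcc_of_le ht.1] at hs
    simp [hP s ⟨hs.1, hs.2.trans ht.2⟩, lagrangian, R.smoothHamiltonian_zero_right]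
  rw [charSolution, action, ← hx, h0, hrc x hxD hxr.le]
  simp

end IsBicharacteristicFlow
end ReactionNetwork

/-- The derivative is nonnegative at a maximum over `[0, t]`. -/
theorem deriv_nonneg_of_forall_le {f : ℝ → ℝ} {f' T t : ℝ} (ht : 0 < t) (htT : t ≤ T)
    (hf : HasDerivWithinAt f f' (Icc 0 T) t) (hmax : ∀ s ∈ Icc 0 t, f s ≤ f t) : 0 ≤ f' := by
  have hf2 := (hf.mono (Icc_subset_Icc_right htT)).hasFDerivWithinAt
  have hloc : IsLocalMaxOn f (Icc 0 t) t := by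
    filter_upwards [self_mem_nhdsWithin] with s hs using hmax s hs
  -- Only backward variations are admissible at the right endpoint, hence an inequality for the
  -- derivative.
  have hcone : (0 : ℝ) - t ∈ posTangentConeAt (Icc 0 t) t := by
    refine sub_mem_posTangentConeAt_of_segment_subset ?_
    rw [segment_symm, segment_eq_Icc ht.le]
  have := hloc.hasFDerivWithinAt_nonpos hf2 hcone
  simp at this
  nlinarith

/-! ### Uniqueness of classical solutions -/

namespace ReactionNetwork

variable {N M : ℕ} {R : ReactionNetwork N M} {u0 : Conc N → ℝ} {T : ℝ}

/-- The reaction vector `ν_j` in concentration space. -/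
def nuVec (R : ReactionNetwork N M) (j : Fin M) : Conc N := WithLp.toLp 2 fun l => (R.nu j l : ℝ)

theorem inner_nuVec (R : ReactionNetwork N M) (j : Fin M) (p : Conc N) :
    inner ℝ p (R.nuVec j) = R.nuDot j p := by
  simp [nuVec, nuDot, PiLp.inner_apply]

theorem totalMass_nuVec {m : Fin N → ℝ} (hm : ∀ j, ∑ l, (R.nu j l : ℝ) * m l = 0) (j : Fin M) :
    totalMass m (R.nuVec j) = 0 := by
  rw [← hm j]
  simp [totalMass, nuVec, mul_comm]

theorem hamiltonian_congr (R : ReactionNetwork N M) {p q : Conc N}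
    (h : ∀ j, R.nuDot j p = R.nuDot j q) (x : Conc N) :
    R.hamiltonian p x = R.hamiltonian q x := by
  simp only [hamiltonian, h]

namespace IsClassicalSolution

variable {u v : ℝ → Conc N → ℝ}

theorem eq_init_of_notMem (hu : R.IsClassicalSolution u0 T u) {t : ℝ} (ht : t ∈ Icc 0 T)
    {x : Conc N} (hx : x ∉ orthant N) : u t x = u0 x := by
  rw [← hu.init x]
  refine eq_of_hasDerivWithinAt_zero (f := fun s => u s x) (fun s hs => ?_) ht
  exact (hu.eq_compl s hs x hx).congr_deriv (R.hamiltonian_of_notMem _ hx)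

theorem eq_init_of_mem_closure_compl (hu : R.IsClassicalSolution u0 T u)
    (hLip : R.LocallyLipschitzRates) {t : ℝ} (ht : t ∈ Icc 0 T)
    {x : Conc N} (hx : x ∈ orthant N) (hx' : x ∈ closure (orthant N)ᶜ) : u t x = u0 x := by
  rw [← hu.init x]
  refine eq_of_hasDerivWithinAt_zero (f := fun s => u s x) (fun s hs => ?_) ht
  exact (hu.eq_orthant s hs x hx).congr_deriv (R.hamiltonian_of_mem_closure_compl hLip _ hx')

theorem hasGradientAt (hu : R.IsClassicalSolution u0 T u) {t : ℝ} (ht : t ∈ Icc 0 T)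
    {x : Conc N} (hx : x ∈ interior (orthant N)) :
    HasGradientAt (u t) (gradientWithin (u t) (orthant N) x) x := by
  have hxo := interior_subset hx
  have h1 : DifferentiableWithinAt ℝ (u t) (orthant N) x :=
    ((hu.contDiffOn_orthant.differentiableOn one_ne_zero (t, x) ⟨ht, hxo⟩).comp x
      (hasFDerivAt_prodMk_right (𝕜 := ℝ) t x).differentiableAt.differentiableWithinAt
      (fun y hy => ⟨ht, hy⟩) : DifferentiableWithinAt ℝ (fun y => u t y) (orthant N) x)
  exact HasFDerivWithinAt.hasFDerivAt h1.hasGradientWithinAt.hasFDerivWithinAt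
    (mem_interior_iff_mem_nhds.1 hx)

/-- At a maximum of `u - v` over a mass level the two Hamiltonians agree, since they see only
derivatives along the level. -/
theorem nuDot_eq_of_isMax {m : Fin N → ℝ} (hm : ∀ j, ∑ l, (R.nu j l : ℝ) * m l = 0)
    (hu : R.IsClassicalSolution u0 T u) (hv : R.IsClassicalSolution u0 T v) {t : ℝ}
    (ht : t ∈ Icc 0 T) {x : Conc N} (hx : x ∈ interior (orthant N))
    (hmax : ∀ y ∈ orthant N, totalMass m y = totalMass m x → u t y - v t y ≤ u t x - v t x)
    (j : Fin M) :
    R.nuDot j (gradientWithin (u t) (orthant N) x)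
      = R.nuDot j (gradientWithin (v t) (orthant N) x) := by
  have hline : HasDerivAt (fun s : ℝ => x + s • R.nuVec j) (R.nuVec j) 0 := by
    simpa using ((hasDerivAt_id (0 : ℝ)).smul_const (R.nuVec j)).const_add x
  have hcomp : ∀ w, R.IsClassicalSolution u0 T w →
      HasDerivAt (fun s : ℝ => w t (x + s • R.nuVec j))
        (R.nuDot j (gradientWithin (w t) (orthant N) x)) 0 := by
    intro w hw
    have h1 : HasFDerivAt (w t) (InnerProductSpace.toDual ℝ (Conc N)
        (gradientWithin (w t) (orthant N) x)) (x + (0 : ℝ) • R.nuVec j) := by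
      simpa using (hw.hasGradientAt ht hx).hasFDerivAt
    have h2 := h1.comp_hasDerivAt 0 hline
    rwa [InnerProductSpace.toDual_apply_apply, inner_nuVec] at h2
  -- The line in direction `ν_j` stays on the mass level, and near the interior point `x` in the
  -- orthant, in both directions.
  have hloc : IsLocalMax (fun s : ℝ => u t (x + s • R.nuVec j) - v t (x + s • R.nuVec j)) 0 := by
    have hcont : Filter.Tendsto (fun s : ℝ => x + s • R.nuVec j) (nhds 0) (nhds x) := by
      simpa using hline.continuousAt.tendsto
    filter_upwards [hcont (mem_interior_iff_mem_nhds.1 hx)] with s hs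
    simp only [zero_smul, add_zero]
    refine hmax _ hs ?_
    rw [totalMass_add_smul, totalMass_nuVec hm, mul_zero, add_zero]
  exact sub_eq_zero.1 (hloc.hasDerivAt_eq_zero ((hcomp u hu).sub (hcomp v hv)))

theorem le_of_isClassicalSolution {m : Fin N → ℝ} (hmpos : ∀ l, 0 < m l)
    (hm : ∀ j, ∑ l, (R.nu j l : ℝ) * m l = 0) (hLip : R.LocallyLipschitzRates) (hT : 0 < T)
    (hu : R.IsClassicalSolution u0 T u) (hv : R.IsClassicalSolution u0 T v) {t : ℝ}
    (ht : t ∈ Icc 0 T) {x : Conc N} (hx : x ∈ orthant N) : u t x ≤ v t x := by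
  by_contra! hlt
  set d := u t x - v t x with hd
  have hdpos : 0 < d := sub_pos.2 hlt
  -- The penalty `ε * t` then uses up at most half of the gap `d`.
  set ε := d / (2 * T) with hε
  have hεpos : 0 < ε := by positivity
  set A := {y ∈ orthant N | totalMass m y = totalMass m x} with hA
  have hAc : IsCompact A := (isCompact_massSublevel hmpos (totalMass m x)).of_isClosed_subset
    (isClosed_orthant.inter (isClosed_eq (continuous_totalMass m) continuous_const))
    fun y hy => ⟨hy.1, hy.2.le⟩
  have hcont : ContinuousOn (fun q : ℝ × Conc N => u q.1 q.2 - v q.1 q.2 - ε * q.1)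
      (Icc 0 T ×ˢ A) := by
    refine ((hu.continuousOn.mono ?_).sub (hv.continuousOn.mono ?_)).sub
      (by fun_prop) <;> exact prod_mono le_rfl (subset_univ _)
  obtain ⟨⟨s, y⟩, ⟨hs, hy⟩, hmax⟩ :=
    (isCompact_Icc.prod hAc).exists_isMaxOn ⟨(t, x), ht, hx, rfl⟩ hcont
  have hmax' : ∀ τ ∈ Icc 0 T, ∀ z ∈ A, u τ z - v τ z - ε * τ ≤ u s y - v s y - ε * s :=
    fun τ hτ z hz => hmax (show (τ, z) ∈ Icc 0 T ×ˢ A from ⟨hτ, hz⟩)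
  simp only at hs hy
  have hpos : 0 < u s y - v s y := by
    have h1 := hmax' t ht x ⟨hx, rfl⟩
    have h2 : ε * t ≤ d / 2 := by
      calc ε * t ≤ ε * T := by gcongr; exact ht.2
        _ = d / 2 := by rw [hε]; field_simp
    have h3 : 0 ≤ ε * s := mul_nonneg hεpos.le hs.1
    linarith
  have hyint : y ∈ interior (orthant N) := by
    by_contra hyn
    have hyc : y ∈ closure (orthant N)ᶜ := by
      rw [closure_compl]; exact hyn
    rw [hu.eq_init_of_mem_closure_compl hLip hs hy.1 hyc,
      hv.eq_init_of_mem_closure_compl hLip hs hy.1 hyc] at hpos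
    linarith
  have hs0 : 0 < s := by
    rcases hs.1.eq_or_lt with h | h
    · rw [← h, hu.init, hv.init] at hpos
      linarith
    · exact h
  have hH := R.hamiltonian_congr (hu.nuDot_eq_of_isMax hm hv hs hyint (fun z hz hzm => by
    have := hmax' s hs z ⟨hz, hzm.trans hy.2⟩
    linarith)) y
  -- The Hamiltonians cancel, so this derivative equals `-ε`; at a maximum over `[0, s]` it cannot
  -- be negative.
  have hder := ((hu.eq_orthant s hs y hy.1).sub (hv.eq_orthant s hs y hy.1)).sub
    ((hasDerivWithinAt_id s (Icc 0 T)).const_mul ε)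
  have := deriv_nonneg_of_forall_le hs0 hs.2 hder (fun τ hτ => by
    simpa using hmax' τ ⟨hτ.1, hτ.2.trans hs.2⟩ y hy)
  rw [hH] at this
  linarith

/-- Classical solutions are unique. -/
theorem eq_of_isClassicalSolution (hmass : R.ConservesMass) (hLip : R.LocallyLipschitzRates)
    (hT : 0 < T) (hu : R.IsClassicalSolution u0 T u) (hv : R.IsClassicalSolution u0 T v) {t : ℝ}
    (ht : t ∈ Icc 0 T) (x : Conc N) : u t x = v t x := by
  obtain ⟨m, hmpos, hm⟩ := hmass
  by_cases hx : x ∈ orthant N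
  · exact le_antisymm (hu.le_of_isClassicalSolution hmpos hm hLip hT hv ht hx)
      (hv.le_of_isClassicalSolution hmpos hm hLip hT hu ht hx)
  · rw [hu.eq_init_of_notMem ht hx, hv.eq_init_of_notMem ht hx]

end IsClassicalSolution

/-! ### Existence: gluing along the boundary -/

open Classical in
/-- The solution by characteristics in the orthant, and the initial data outside. -/
def extendedSolution (R : ReactionNetwork N M) (u0 : Conc N → ℝ) (X P : ℝ → Conc N → Conc N)
    (t : ℝ) (x : Conc N) : ℝ :=
  if x ∈ orthant N then R.charSolution u0 X P t x else u0 x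

theorem extendedSolution_of_mem {X P : ℝ → Conc N → Conc N} {t : ℝ} {x : Conc N}
    (hx : x ∈ orthant N) : R.extendedSolution u0 X P t x = R.charSolution u0 X P t x := if_pos hx

theorem extendedSolution_of_notMem {X P : ℝ → Conc N → Conc N} {t : ℝ} {x : Conc N}
    (hx : x ∉ orthant N) : R.extendedSolution u0 X P t x = u0 x := if_neg hx

theorem IsBicharacteristicFlow.isClassicalSolution {X P : ℝ → Conc N → Conc N} {m : Fin N → ℝ}
    (hf : R.IsBicharacteristicFlow u0 T X P) (hu0 : ContDiff ℝ 2 u0) (hT : 0 < T)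
    (hbi : ∀ t ∈ Icc 0 T, BijOn (X t) (orthant N) (orthant N) ∧
      ∀ x₀ ∈ orthant N, (fderivWithin ℝ (X t) (orthant N) x₀).IsInvertible)
    (hmpos : ∀ l, 0 < m l) (hm : ∀ j, ∑ l, (R.nu j l : ℝ) * m l = 0)
    (hLip : R.LocallyLipschitzRates) :
    R.IsClassicalSolution u0 T (R.extendedSolution u0 X P) := by
  have h0 : (0 : ℝ) ∈ Icc 0 T := ⟨le_rfl, hT.le⟩
  have hinit : ∀ x, R.extendedSolution u0 X P 0 x = u0 x := by
    intro x
    by_cases hx : x ∈ orthant N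
    · rw [extendedSolution_of_mem hx, hf.charSolution_zero (hbi 0 h0).1 hx]
    · exact extendedSolution_of_notMem hx
  have hC1 : ContDiffOn ℝ 1 (fun q : ℝ × Conc N => R.extendedSolution u0 X P q.1 q.2)
      (Icc 0 T ×ˢ orthant N) :=
    (hf.contDiffOn_charSolution hu0 hT hbi hmpos hm).congr
      fun q hq => extendedSolution_of_mem hq.2
  have hu0C : ContDiff ℝ 1 (fun q : ℝ × Conc N => u0 q.2) :=
    (hu0.of_le (by norm_num)).comp contDiff_snd
  have hpde : ∀ t ∈ Icc 0 T, ∀ x ∈ orthant N,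
      HasDerivWithinAt (fun s => R.extendedSolution u0 X P s x)
        (R.hamiltonian (gradientWithin (R.extendedSolution u0 X P t) (orthant N) x) x)
        (Icc 0 T) t := by
    intro t ht x hx
    have hg : gradientWithin (R.extendedSolution u0 X P t) (orthant N) x
        = charGradient X P t x :=
      ((hf.hasGradientWithinAt_charSolution hu0 hT.le hbi hmpos hm ht hx).congr
        (fun y hy => extendedSolution_of_mem hy)
        (extendedSolution_of_mem hx)).gradientWithin_eq (uniqueDiffOn_orthant x hx)
    rw [hg, R.hamiltonian_of_mem _ hx]
    simp only [extendedSolution_of_mem hx]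
    exact hf.hasDeriv_charSolution hu0 hbi hmpos hm ht hx
  refine ⟨hinit, ?_, hC1, ?_, hpde, ?_⟩
  -- A cover by two closed sets. On the second one the function equals `u0`, also at boundary
  -- points, where `H` vanishes.
  · have huniv : Icc 0 T ×ˢ (univ : Set (Conc N))
        = Icc 0 T ×ˢ orthant N ∪ Icc 0 T ×ˢ closure (orthant N)ᶜ := by
      rw [← prod_union]
      congr 1
      refine (eq_univ_of_forall fun x => ?_).symm
      by_cases hx : x ∈ orthant N
      · exact Or.inl hx
      · exact Or.inr (subset_closure hx)
    rw [huniv]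
    refine ContinuousOn.union_of_isClosed hC1.continuousOn ?_
      (isClosed_Icc.prod isClosed_orthant) (isClosed_Icc.prod isClosed_closure)
    refine hu0C.continuous.continuousOn.congr fun q hq => ?_
    by_cases hx : q.2 ∈ orthant N
    · have := eq_of_hasDerivWithinAt_zero (f := fun s => R.extendedSolution u0 X P s q.2)
        (fun s hs => (hpde s hs q.2 hx).congr_deriv
          (R.hamiltonian_of_mem_closure_compl hLip _ hq.2)) hq.1
      simpa only [hinit] using this
    · exact extendedSolution_of_notMem hx
  · exact hu0C.contDiffOn.congr fun q hq => extendedSolution_of_notMem hq.2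
  · intro t ht x hx
    rw [R.hamiltonian_of_notMem _ hx]
    simp only [extendedSolution_of_notMem hx]
    exact hasDerivWithinAt_const _ _ _

end ReactionNetwork

/-! ### Grid levels and mesoscopic rates -/

section Grid

variable {N : ℕ}

theorem gridPoint_mem_orthant_iff {h : ℝ} (hh : 0 < h) {i : Fin N → ℤ} :
    gridPoint h i ∈ orthant N ↔ ∀ l, 0 ≤ i l := by
  refine forall_congr' fun l => ?_
  simp [gridPoint, mul_nonneg_iff_of_pos_left hh]

theorem totalMass_gridPoint (m : Fin N → ℝ) (h : ℝ) (i : Fin N → ℤ) :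
    totalMass m (gridPoint h i) = h * ∑ l, m l * i l := by
  simp only [totalMass, gridPoint, Finset.mul_sum]
  exact Finset.sum_congr rfl fun l _ => by ring

/-- The nonnegative grid indices on the same mass level as `i`. -/
def gridLevel (m : Fin N → ℝ) (i : Fin N → ℤ) : Set (Fin N → ℤ) :=
  {k | (∀ l, 0 ≤ k l) ∧ ∑ l, m l * k l = ∑ l, m l * i l}

theorem finite_gridLevel {m : Fin N → ℝ} (hm : ∀ l, 0 < m l) (i : Fin N → ℤ) :
    (gridLevel m i).Finite := by
  set b : Fin N → ℤ := fun l => ⌈(∑ l, m l * i l) / m l⌉ with hb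
  refine (Set.finite_Icc (0 : Fin N → ℤ) b).subset fun k hk => ⟨hk.1, fun l => ?_⟩
  have h1 : m l * k l ≤ ∑ l, m l * i l := by
    rw [← hk.2]
    exact Finset.single_le_sum (f := fun l => m l * (k l : ℝ))
      (fun l _ => mul_nonneg (hm l).le (by exact_mod_cast hk.1 l)) (Finset.mem_univ l)
  have h2 : (k l : ℝ) ≤ (∑ l, m l * i l) / m l := by
    rw [le_div_iff₀ (hm l), mul_comm]; exact h1
  exact_mod_cast h2.trans (Int.le_ceil _)

theorem mesoMassAction_nonneg {k : ℝ} (hk : 0 ≤ k) (a : Fin N → ℕ) {h : ℝ} (hh : 0 < h)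
    (i : Fin N → ℤ) : 0 ≤ mesoMassAction k a h i := by
  unfold mesoMassAction
  split_ifs
  · exact mul_nonneg hk (Finset.prod_nonneg fun l _ => by positivity)
  · exact le_rfl

/-- A nonzero rate means that the reactants are present. The target of the reaction is then
nonnegative, so the no-reaction constraint never discards a nonzero term at a nonnegative index. -/
theorem le_of_mesoMassAction_ne_zero {k : ℝ} {a : Fin N → ℕ} {h : ℝ} {i : Fin N → ℤ}
    (hne : mesoMassAction k a h i ≠ 0) (l : Fin N) : (a l : ℤ) ≤ i l := by
  by_contra! hlt
  refine hne ?_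
  unfold mesoMassAction
  split_ifs with hi
  · rw [Finset.prod_eq_zero (Finset.mem_univ l), mul_zero]
    rw [Nat.descFactorial_eq_zero_iff_lt.2, Nat.cast_zero, zero_mul]
    have := hi l
    omega
  · rfl

/-- Each new factor is `h (n - a)` instead of `h n`, a change of at most `a h`. With truncated
subtraction this also holds for `n < a`, so small `n` need no separate case. -/
theorem exists_descFactorial_bound (a : ℕ) (B : ℝ) (hB : 0 ≤ B) :
    ∃ C : ℝ, 0 ≤ C ∧ ∀ h : ℝ, 0 < h → ∀ n : ℕ, h * n ≤ B →
      0 ≤ (n.descFactorial a : ℝ) * h ^ a ∧ (n.descFactorial a : ℝ) * h ^ a ≤ (h * n) ^ a ∧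
      (h * n) ^ a - (n.descFactorial a : ℝ) * h ^ a ≤ C * h := by
  have hle : ∀ a : ℕ, ∀ h : ℝ, 0 < h → ∀ n : ℕ,
      (n.descFactorial a : ℝ) * h ^ a ≤ (h * n) ^ a := by
    intro a h hh n
    rw [mul_pow, mul_comm]
    gcongr
    exact_mod_cast Nat.descFactorial_le_pow n a
  induction a with
  | zero => exact ⟨0, le_rfl, fun h hh n _ => by simp⟩
  | succ a ih =>
    obtain ⟨C, hC, ih⟩ := ih
    refine ⟨B * C + a * B ^ a, by positivity, fun h hh n hn =>
      ⟨by positivity, hle _ h hh n, ?_⟩⟩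
    obtain ⟨h1, h2, h3⟩ := ih h hh n hn
    set f := (n.descFactorial a : ℝ) * h ^ a with hf
    have hsub : (n : ℝ) - ((n - a : ℕ) : ℝ) ≤ a := by
      have : (n : ℝ) ≤ ((n - a : ℕ) : ℝ) + a := by exact_mod_cast (by omega : n ≤ n - a + a)
      linarith
    have e1 : ((n.descFactorial (a + 1) : ℕ) : ℝ) * h ^ (a + 1) = h * ((n - a : ℕ) : ℝ) * f := by
      rw [Nat.descFactorial_succ, hf]
      push_cast
      ring
    have hfB : f ≤ B ^ a := h2.trans (by gcongr)
    calc (h * n) ^ (a + 1) - ((n.descFactorial (a + 1) : ℕ) : ℝ) * h ^ (a + 1)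
        = h * n * ((h * n) ^ a - f) + h * ((n : ℝ) - ((n - a : ℕ) : ℝ)) * f := by
          rw [e1]; ring
      _ ≤ B * (C * h) + h * a * B ^ a := by
          gcongr
      _ = (B * C + a * B ^ a) * h := by ring

theorem exists_prod_bound (s : Finset (Fin N)) (a : Fin N → ℕ) (B : ℝ) (hB : 0 ≤ B) :
    ∃ C : ℝ, 0 ≤ C ∧ ∀ h : ℝ, 0 < h → ∀ n : Fin N → ℕ, (∀ l, h * n l ≤ B) →
      0 ≤ ∏ l ∈ s, ((n l).descFactorial (a l) : ℝ) * h ^ a l ∧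
      ∏ l ∈ s, ((n l).descFactorial (a l) : ℝ) * h ^ a l ≤ C ∧
      0 ≤ ∏ l ∈ s, (h * n l) ^ a l - ∏ l ∈ s, ((n l).descFactorial (a l) : ℝ) * h ^ a l ∧
      ∏ l ∈ s, (h * n l) ^ a l - ∏ l ∈ s, ((n l).descFactorial (a l) : ℝ) * h ^ a l ≤ C * h := by
  classical
  induction s using Finset.induction_on with
  | empty => exact ⟨1, zero_le_one, fun h hh n _ => by simp [hh.le]⟩
  | insert l s hl ih =>
    obtain ⟨C, hC, ih⟩ := ih
    obtain ⟨C', hC', h'⟩ := exists_descFactorial_bound (a l) B hB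
    refine ⟨B ^ a l * C + C' * C, by positivity, fun h hh n hn => ?_⟩
    obtain ⟨h1, h2, h3, h4⟩ := ih h hh n hn
    obtain ⟨g1, g2, g3⟩ := h' h hh (n l) (hn l)
    simp only [Finset.prod_insert hl]
    set f := ∏ l ∈ s, ((n l).descFactorial (a l) : ℝ) * h ^ a l
    set g := ∏ l ∈ s, (h * (n l : ℝ)) ^ a l
    set f₀ := ((n l).descFactorial (a l) : ℝ) * h ^ a l
    set g₀ := (h * (n l : ℝ)) ^ a l
    have hg₀ : g₀ ≤ B ^ a l := pow_le_pow_left₀ (by positivity) (hn l) _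
    have e : g₀ * g - f₀ * f = g₀ * (g - f) + (g₀ - f₀) * f := by ring
    have hd : 0 ≤ g₀ - f₀ := sub_nonneg.2 g2
    have hg₀' : 0 ≤ g₀ := g1.trans g2
    refine ⟨mul_nonneg g1 h1, ?_, ?_, ?_⟩
    · calc f₀ * f ≤ B ^ a l * C := by gcongr; exact g2.trans hg₀
        _ ≤ _ := by linarith [mul_nonneg hC' hC]
    · rw [e]
      exact add_nonneg (mul_nonneg hg₀' h3) (mul_nonneg hd h1)
    · rw [e]
      calc g₀ * (g - f) + (g₀ - f₀) * f ≤ B ^ a l * (C * h) + C' * h * C := by gcongr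
        _ = _ := by ring

/-- The mesoscopic rates approximate the macroscopic ones to first order in `h`. -/
theorem exists_mesoMassAction_bound {k : ℝ} (hk : 0 ≤ k) (a : Fin N → ℕ) (B : ℝ) (hB : 0 ≤ B) :
    ∃ C : ℝ, 0 ≤ C ∧ ∀ h : ℝ, 0 < h → ∀ i : Fin N → ℤ, (∀ l, 0 ≤ i l) →
      ‖gridPoint h i‖ ≤ B → mesoMassAction k a h i ≤ C ∧
      |mesoMassAction k a h i - massPoly k a (gridPoint h i)| ≤ C * h := by
  obtain ⟨C, hC, h'⟩ := exists_prod_bound Finset.univ a B hB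
  refine ⟨k * C, mul_nonneg hk hC, fun h hh i hi hiB => ?_⟩
  have hcast : ∀ l, (((i l).toNat : ℕ) : ℝ) = i l := fun l => by
    exact_mod_cast Int.toNat_of_nonneg (hi l)
  obtain ⟨h1, h2, h3, h4⟩ := h' h hh (fun l => (i l).toNat) (fun l => by
    have e1 := (PiLp.norm_apply_le (gridPoint h i) l).trans hiB
    rw [hcast]
    exact (le_abs_self _).trans e1)
  have e1 : mesoMassAction k a h i
      = k * ∏ l, (((i l).toNat.descFactorial (a l) : ℝ) * h ^ a l) := if_pos hi
  have e2 : massPoly k a (gridPoint h i) = k * ∏ l, (h * ((i l).toNat : ℝ)) ^ a l := by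
    simp only [massPoly, gridPoint, hcast]
  rw [e1, e2]
  refine ⟨by gcongr, ?_⟩
  rw [← mul_sub, abs_mul, abs_of_nonneg hk, abs_sub_comm, abs_of_nonneg h3, mul_assoc]
  gcongr

end Grid

theorem abs_exp_sub_exp_le {G a b : ℝ} (ha : a ≤ G) (hb : b ≤ G) :
    |Real.exp a - Real.exp b| ≤ Real.exp G * |a - b| :=
  (convex_Iic G).norm_image_sub_le_of_norm_hasDerivWithin_le
    (fun x _ => (Real.hasDerivAt_exp x).hasDerivWithinAt)
    (fun x hx => by rw [Real.norm_of_nonneg (Real.exp_pos x).le]; exact Real.exp_le_exp.2 hx) hb ha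

/-! ### Discrete comparison principles -/

namespace ReactionNetwork

variable {N M : ℕ} {R : ReactionNetwork N M} {T h : ℝ} {m : Fin N → ℝ}

theorem sum_add_nu (hm : ∀ j, ∑ l, (R.nu j l : ℝ) * m l = 0) (i : Fin N → ℤ) (j : Fin M) :
    ∑ l, m l * ((i + R.nu j) l : ℝ) = ∑ l, m l * (i l : ℝ) := by
  simp only [Pi.add_apply, Int.cast_add, mul_add, Finset.sum_add_distrib]
  rw [add_eq_left, ← hm j]
  exact Finset.sum_congr rfl fun l _ => mul_comm _ _

theorem sum_sub_nu (hm : ∀ j, ∑ l, (R.nu j l : ℝ) * m l = 0) (i : Fin N → ℤ) (j : Fin M) :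
    ∑ l, m l * ((i - R.nu j) l : ℝ) = ∑ l, m l * (i l : ℝ) := by
  have := sum_add_nu hm (i - R.nu j) j
  rwa [sub_add_cancel, eq_comm] at this

theorem discreteHamiltonian_of_neg {i : Fin N → ℤ} (hi : ¬ ∀ l, 0 ≤ i l)
    (w : (Fin N → ℤ) → ℝ) : R.discreteHamiltonian h w i = 0 := by
  simp [discreteHamiltonian, mesoMassAction, hi]

/-- Monotonicity of the scheme: at a maximum of `w - v` over a mass level, the discrete
Hamiltonian of `w` is at most that of `v`. -/
theorem discreteHamiltonian_le_of_isMax (hm : ∀ j, ∑ l, (R.nu j l : ℝ) * m l = 0) (hh : 0 < h)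
    {w v : (Fin N → ℤ) → ℝ} {i : Fin N → ℤ}
    (hmax : ∀ k ∈ gridLevel m i, w k - v k ≤ w i - v i) :
    R.discreteHamiltonian h w i ≤ R.discreteHamiltonian h v i := by
  refine add_le_add (Finset.sum_le_sum fun j _ => ?_) (Finset.sum_le_sum fun j _ => ?_)
  · split_ifs with hc
    · have := hmax (i + R.nu j) ⟨hc, sum_add_nu hm i j⟩
      have hle : w (i + R.nu j) - w i ≤ v (i + R.nu j) - v i := by linarith
      gcongr _ * (Real.exp (?_ / h) - 1)
      exact mesoMassAction_nonneg (R.kPlus_nonneg j) _ hh i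
    · exact le_rfl
  · split_ifs with hc
    · have := hmax (i - R.nu j) ⟨hc, sum_sub_nu hm i j⟩
      have hle : w (i - R.nu j) - w i ≤ v (i - R.nu j) - v i := by linarith
      gcongr _ * (Real.exp (?_ / h) - 1)
      exact mesoMassAction_nonneg (R.kMinus_nonneg j) _ hh i
    · exact le_rfl

/-- Comparison of approximate sub- and supersolutions of the backward Euler scheme. -/
theorem backwardEuler_comparison (hmpos : ∀ l, 0 < m l)
    (hm : ∀ j, ∑ l, (R.nu j l : ℝ) * m l = 0) (hh : 0 < h) {dt ε δ₁ δ₂ : ℝ} (hdt : 0 < dt)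
    {w v : ℕ → (Fin N → ℤ) → ℝ} (h0 : ∀ i, w 0 i ≤ v 0 i + ε)
    (hw : ∀ n : ℕ, ((n + 1 : ℕ) : ℝ) * dt ≤ T → ∀ i, (∀ l, 0 ≤ i l) →
      w (n + 1) i - w n i ≤ dt * (R.discreteHamiltonian h (w (n + 1)) i + δ₁))
    (hv : ∀ n : ℕ, ((n + 1 : ℕ) : ℝ) * dt ≤ T → ∀ i, (∀ l, 0 ≤ i l) →
      dt * (R.discreteHamiltonian h (v (n + 1)) i - δ₂) ≤ v (n + 1) i - v n i) :
    ∀ n : ℕ, (n : ℝ) * dt ≤ T → ∀ i, (∀ l, 0 ≤ i l) →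
      w n i ≤ v n i + ε + n * dt * (δ₁ + δ₂) := by
  intro n
  induction n with
  | zero => intro _ i _; simpa using h0 i
  | succ n ih =>
    intro hn i hi
    -- The maximum is taken at the new time level, where the implicit scheme evaluates its
    -- Hamiltonian; hence no restriction on the time step.
    obtain ⟨k, hk, hmax⟩ := Set.exists_max_image (gridLevel m i)
      (fun k => w (n + 1) k - v (n + 1) k) (finite_gridLevel hmpos i) ⟨i, hi, rfl⟩
    have hnT : (n : ℝ) * dt ≤ T := by
      push_cast at hn
      linarith
    have h1 := ih hnT k hk.1
    have h2 := hw n hn k hk.1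
    have h3 := hv n hn k hk.1
    have h4 := discreteHamiltonian_le_of_isMax (R := R) hm hh (w := w (n + 1)) (v := v (n + 1))
      (i := k) (fun k' hk' => hmax k' ⟨hk'.1, hk'.2.trans hk.2⟩)
    have h5 := mul_le_mul_of_nonneg_left h4 hdt.le
    have h6 := hmax i ⟨hi, rfl⟩
    push_cast
    nlinarith

/-- Comparison of approximate sub- and supersolutions of the semi-discrete scheme. -/
theorem monotoneScheme_comparison (hmpos : ∀ l, 0 < m l)
    (hm : ∀ j, ∑ l, (R.nu j l : ℝ) * m l = 0) (hh : 0 < h) {ε δ₁ δ₂ : ℝ}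
    {w v w' v' : ℝ → (Fin N → ℤ) → ℝ} (h0 : ∀ i, w 0 i ≤ v 0 i + ε)
    (hwc : ∀ i, (∀ l, 0 ≤ i l) → ContinuousOn (fun t => w t i) (Icc 0 T))
    (hvc : ∀ i, (∀ l, 0 ≤ i l) → ContinuousOn (fun t => v t i) (Icc 0 T))
    (hwd : ∀ i, (∀ l, 0 ≤ i l) → ∀ t ∈ Ioo 0 T, HasDerivAt (fun s => w s i) (w' t i) t)
    (hvd : ∀ i, (∀ l, 0 ≤ i l) → ∀ t ∈ Ioo 0 T, HasDerivAt (fun s => v s i) (v' t i) t)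
    (hw : ∀ i, (∀ l, 0 ≤ i l) → ∀ t ∈ Ioo 0 T, w' t i ≤ R.discreteHamiltonian h (w t) i + δ₁)
    (hv : ∀ i, (∀ l, 0 ≤ i l) → ∀ t ∈ Ioo 0 T, R.discreteHamiltonian h (v t) i - δ₂ ≤ v' t i)
    {t : ℝ} (ht : t ∈ Icc 0 T) {i : Fin N → ℤ} (hi : ∀ l, 0 ≤ i l) (hT : 0 < T) :
    w t i ≤ v t i + ε + t * (δ₁ + δ₂) := by
  -- The differential inequalities hold only on the open interval; the endpoints follow by
  -- continuity.
  suffices hopen : ∀ t ∈ Ioo 0 T, w t i ≤ v t i + ε + t * (δ₁ + δ₂) by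
    have hcl : closure (Ioo 0 T) = Icc 0 T := closure_Ioo hT.ne
    rw [← hcl] at ht
    refine le_on_closure (f := fun t => w t i) (g := fun t => v t i + ε + t * (δ₁ + δ₂)) hopen
      ?_ ?_ ht
    · rw [hcl]; exact hwc i hi
    · rw [hcl]
      exact ((hvc i hi).add continuousOn_const).add (by fun_prop)
  intro t ht
  by_contra! hlt
  set δ := δ₁ + δ₂ with hδ
  set d := w t i - (v t i + ε + t * δ) with hd
  have hdpos : 0 < d := sub_pos.2 hlt
  -- An extra slope `η` spends half of the excess `d` by time `t` and makes the final inequality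
  -- strict.
  set η := d / (2 * t) with hη
  have htpos : 0 < t := ht.1
  have hηpos : 0 < η := by positivity
  set g : ℝ → (Fin N → ℤ) → ℝ := fun s k => w s k - v s k - (δ + η) * s with hg
  have hsub : Icc 0 t ⊆ Icc 0 T := Icc_subset_Icc_right ht.2.le
  -- A maximizing time for each index, with dummy value 0 at negative indices; maximizing next over
  -- the finite level gives a joint maximum.
  have hex : ∀ k : Fin N → ℤ, ∃ s ∈ Icc 0 t, (∀ l, 0 ≤ k l) → ∀ τ ∈ Icc 0 t, g τ k ≤ g s k := by
    intro k
    by_cases hk : ∀ l, 0 ≤ k l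
    · have hc : ContinuousOn (fun s => g s k) (Icc 0 t) :=
        (((hwc k hk).mono hsub).sub ((hvc k hk).mono hsub)).sub (by fun_prop)
      obtain ⟨s, hs, hmax⟩ := isCompact_Icc.exists_isMaxOn ⟨0, le_rfl, htpos.le⟩ hc
      exact ⟨s, hs, fun _ τ hτ => hmax hτ⟩
    · exact ⟨0, ⟨le_rfl, htpos.le⟩, fun h => absurd h hk⟩
  choose σ hσ hσmax using hex
  obtain ⟨k, hk, hkmax⟩ := Set.exists_max_image (gridLevel m i) (fun k => g (σ k) k)
    (finite_gridLevel hmpos i) ⟨i, hi, rfl⟩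
  set s := σ k with hs
  have hgmax : ∀ τ ∈ Icc 0 t, ∀ k' ∈ gridLevel m i, g τ k' ≤ g s k := fun τ hτ k' hk' =>
    (hσmax k' hk'.1 τ hτ).trans (hkmax k' hk')
  have hsmem : s ∈ Icc 0 t := hσ k
  have hval : ε + d / 2 ≤ g s k := by
    refine le_trans (le_of_eq ?_) (hgmax t ⟨htpos.le, le_rfl⟩ i ⟨hi, rfl⟩)
    have : η * t = d / 2 := by rw [hη]; field_simp
    simp only [hg, add_mul, this]
    rw [hd]
    ring
  have hs0 : 0 < s := by
    rcases hsmem.1.eq_or_lt with h' | h'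
    · have h1 := h0 k
      rw [← h'] at hval
      simp only [hg, mul_zero, sub_zero] at hval
      linarith
    · exact h'
  have hsT : s ∈ Ioo 0 T := ⟨hs0, hsmem.2.trans_lt ht.2⟩
  have hH := discreteHamiltonian_le_of_isMax (R := R) hm hh (w := w s) (v := v s)
    (i := k) (fun k' hk' => by
      have := hgmax s hsmem k' ⟨hk'.1, hk'.2.trans hk.2⟩
      simp only [hg] at this
      linarith)
  have hder : HasDerivAt (fun τ => g τ k) (w' s k - v' s k - (δ + η) * 1) s :=
    ((hwd k hk.1 s hsT).sub (hvd k hk.1 s hsT)).sub ((hasDerivAt_id s).const_mul (δ + η))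
  have h1 := deriv_nonneg_of_forall_le hs0 hsmem.2 hder.hasDerivWithinAt
    (fun τ hτ => hgmax τ ⟨hτ.1, hτ.2.trans hsmem.2⟩ k hk)
  have h2 := hw k hk.1 s hsT
  have h3 := hv k hk.1 s hsT
  linarith

/-- First order consistency of a single reaction term. Here `i'` is the target of the reaction
that starts at `i` and consumes `a`. -/
theorem abs_reaction_term_sub_le {k : ℝ} {a b : Fin N → ℕ} {i i' : Fin N → ℤ}
    (hi' : ∀ l, i' l = i l - a l + b l) (hh : 0 < h) {w : (Fin N → ℤ) → ℝ} {Q G Ce Cm c : ℝ}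
    (hmn : 0 ≤ mesoMassAction k a h i) (hmb : mesoMassAction k a h i ≤ Cm) (hCe : 0 ≤ Ce)
    (hmc : |mesoMassAction k a h i - c| ≤ Cm * h) (hQ : |Q| ≤ G)
    (hE : (∀ l, 0 ≤ i' l) → |(w i' - w i) / h| ≤ G ∧ |(w i' - w i) / h - Q| ≤ Ce * h) :
    |(if ∀ l, 0 ≤ i' l then
        mesoMassAction k a h i * (Real.exp ((w i' - w i) / h) - 1) else 0)
      - c * (Real.exp Q - 1)| ≤ (Cm * (Real.exp G * Ce) + Cm * (Real.exp G + 1)) * h := by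
  have hQ1 : |Real.exp Q - 1| ≤ Real.exp G + 1 := by
    have h1 := Real.exp_le_exp.2 ((le_abs_self Q).trans hQ)
    rw [abs_le]
    constructor <;> linarith [Real.exp_pos Q, Real.exp_pos G]
  have hCm : 0 ≤ Cm := hmn.trans hmb
  have hsecond : |mesoMassAction k a h i - c| * |Real.exp Q - 1|
      ≤ Cm * h * (Real.exp G + 1) := by gcongr
  -- If the mesoscopic rate vanishes, the macroscopic one is at most `Cm * h` in absolute value, so
  -- its whole term is an admissible error.
  by_cases hne : mesoMassAction k a h i = 0
  · rw [hne] at hsecond ⊢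
    rw [zero_mul, ite_self, zero_sub, abs_neg, abs_mul]
    rw [zero_sub, abs_neg] at hsecond
    refine hsecond.trans ?_
    have : 0 ≤ Cm * (Real.exp G * Ce) * h := by positivity
    linarith
  · have hpos : ∀ l, 0 ≤ i' l := fun l => by
      have := le_of_mesoMassAction_ne_zero hne l
      rw [hi' l]
      omega
    obtain ⟨hE1, hE2⟩ := hE hpos
    rw [if_pos hpos]
    set E := (w i' - w i) / h
    set μ := mesoMassAction k a h i
    have e : μ * (Real.exp E - 1) - c * (Real.exp Q - 1)
        = μ * (Real.exp E - Real.exp Q) + (μ - c) * (Real.exp Q - 1) := by ring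
    rw [e]
    have h1 := abs_exp_sub_exp_le ((le_abs_self E).trans hE1) ((le_abs_self Q).trans hQ)
    have h2 : |μ * (Real.exp E - Real.exp Q)| ≤ Cm * (Real.exp G * (Ce * h)) := by
      rw [abs_mul, abs_of_nonneg hmn]
      gcongr
      exact h1.trans (by gcongr)
    refine (abs_add_le _ _).trans ?_
    rw [abs_mul (μ - c)]
    linarith

end ReactionNetwork

/-! ### Consistency of the discrete Hamiltonian -/

namespace ReactionNetwork

variable {N M : ℕ} {R : ReactionNetwork N M} {u0 : Conc N → ℝ} {T : ℝ}
  {X P : ℝ → Conc N → Conc N} {m : Fin N → ℝ}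

theorem gridPoint_add_nu (R : ReactionNetwork N M) (h : ℝ) (i : Fin N → ℤ) (j : Fin M) :
    gridPoint h (i + R.nu j) = gridPoint h i + h • R.nuVec j := by
  ext l
  simp [gridPoint, nuVec, mul_add]

theorem gridPoint_sub_nu (R : ReactionNetwork N M) (h : ℝ) (i : Fin N → ℤ) (j : Fin M) :
    gridPoint h (i - R.nu j) = gridPoint h i + h • -R.nuVec j := by
  ext l
  simp [gridPoint, nuVec]
  ring

/-- Difference quotients of a function with a second order expansion on a bounded set. -/
theorem abs_difference_quotient_le {E : Type*} [NormedAddCommGroup E] [InnerProductSpace ℝ E]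
    {f : E → ℝ} {x v q : E} {h C r : ℝ} (hh : 0 < h) (hC : 0 ≤ C) (hq : ‖q‖ ≤ C) (hx : ‖x‖ ≤ r)
    (hxv : ‖x + h • v‖ ≤ r)
    (hf : |f (x + h • v) - f x - inner ℝ q (x + h • v - x)| ≤ C * ‖x + h • v - x‖ ^ 2) :
    |(f (x + h • v) - f x) / h| ≤ C * ‖v‖ + C * (2 * r) * ‖v‖ ∧
    |(f (x + h • v) - f x) / h - inner ℝ q v| ≤ C * ‖v‖ ^ 2 * h := by
  have hr : 0 ≤ r := (norm_nonneg x).trans hx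
  -- Both points lie in a ball of radius `r`. This bounds the exponents without any smallness
  -- condition on `h`.
  have hhv : h * ‖v‖ ≤ 2 * r := by
    have h1 := norm_sub_le (x + h • v) x
    rw [add_sub_cancel_left, norm_smul, Real.norm_of_nonneg hh.le] at h1
    linarith
  have hQ : |inner ℝ q v| ≤ C * ‖v‖ := (abs_real_inner_le_norm q v).trans (by gcongr)
  have h1 : |(f (x + h • v) - f x) / h - inner ℝ q v| ≤ C * ‖v‖ ^ 2 * h := by
    rw [add_sub_cancel_left, norm_smul, Real.norm_of_nonneg hh.le, inner_smul_right] at hf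
    have e : (f (x + h • v) - f x) / h - inner ℝ q v
        = (f (x + h • v) - f x - h * inner ℝ q v) / h := by field_simp
    rw [e, abs_div, abs_of_pos hh, div_le_iff₀ hh]
    refine hf.trans_eq ?_
    ring
  have h2 : C * ‖v‖ ^ 2 * h ≤ C * (2 * r) * ‖v‖ := by
    calc C * ‖v‖ ^ 2 * h = C * (h * ‖v‖) * ‖v‖ := by ring
      _ ≤ _ := by gcongr
  refine ⟨?_, h1⟩
  have h3 := abs_sub_abs_le_abs_sub ((f (x + h • v) - f x) / h) (inner ℝ q v)
  linarith

/-- The solution by characteristics satisfies both schemes up to first order errors: its time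
derivative is Lipschitz in time and close to its discrete Hamiltonian, uniformly. -/
theorem IsBicharacteristicFlow.exists_consistency_bound
    (hf : R.IsBicharacteristicFlow u0 T X P) (hu0 : ContDiff ℝ 2 u0) (hu0c : ConstAtInfinity u0)
    (hT : 0 < T)
    (hbi : ∀ t ∈ Icc 0 T, BijOn (X t) (orthant N) (orthant N) ∧
      ∀ x₀ ∈ orthant N, (fderivWithin ℝ (X t) (orthant N) x₀).IsInvertible)
    (hmpos : ∀ l, 0 < m l) (hm : ∀ j, ∑ l, (R.nu j l : ℝ) * m l = 0) :
    ∃ C : ℝ, 0 ≤ C ∧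
      (∀ t ∈ Icc 0 T, ∀ s ∈ Icc 0 T, ∀ x ∈ orthant N,
        |R.smoothHamiltonian (x, charGradient X P t x)
          - R.smoothHamiltonian (x, charGradient X P s x)| ≤ C * |t - s|) ∧
      (∀ t ∈ Icc 0 T, ∀ h : ℝ, 0 < h → ∀ i : Fin N → ℤ, (∀ l, 0 ≤ i l) →
        |R.discreteHamiltonian h (fun k => R.extendedSolution u0 X P t (gridPoint h k)) i
          - R.smoothHamiltonian (gridPoint h i, charGradient X P t (gridPoint h i))|
          ≤ C * h) := by
  obtain ⟨K, c, hconst⟩ := hf.exists_const_of_large_mass hu0 hu0c (fun t ht => (hbi t ht).1) hm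
  obtain ⟨C, hC, hq, htay, hlip⟩ := hf.exists_charSolution_bounds hu0 hT.le hbi hmpos hm K
  obtain ⟨r', hr'⟩ := (isCompact_massSublevel hmpos K).isBounded.subset_closedBall (0 : Conc N)
  set r := |r'| with hrdef
  have hr : ∀ x ∈ massSublevel m K, ‖x‖ ≤ r := fun x hx =>
    (mem_closedBall_zero_iff.1 (hr' hx)).trans (le_abs_self _)
  have hr0 : 0 ≤ r := abs_nonneg _
  obtain ⟨L, hL, hHlip⟩ :=
    exists_lipschitz_closedBall (R.contDiff_smoothHamiltonian (n := 1)) (max r C)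
  choose Cp hCp hp using fun j =>
    exists_mesoMassAction_bound (R.kPlus_nonneg j) (R.nuPlus j) r hr0
  choose Cn hCn hn using fun j =>
    exists_mesoMassAction_bound (R.kMinus_nonneg j) (R.nuMinus j) r hr0
  set G : Fin M → ℝ := fun j => C * ‖R.nuVec j‖ + C * (2 * r) * ‖R.nuVec j‖ with hG
  set Ce : Fin M → ℝ := fun j => C * ‖R.nuVec j‖ ^ 2 with hCe
  set Kp : Fin M → ℝ := fun j =>
    Cp j * (Real.exp (G j) * Ce j) + Cp j * (Real.exp (G j) + 1) with hKp
  set Kn : Fin M → ℝ := fun j =>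
    Cn j * (Real.exp (G j) * Ce j) + Cn j * (Real.exp (G j) + 1) with hKn
  have hCe0 : ∀ j, 0 ≤ Ce j := fun j => by positivity
  have hKp0 : ∀ j, 0 ≤ Kp j := fun j => by
    have := hCp j; have := hCe0 j; positivity
  have hKn0 : ∀ j, 0 ≤ Kn j := fun j => by
    have := hCn j; have := hCe0 j; positivity
  have hS : 0 ≤ ∑ j, (Kp j + Kn j) :=
    Finset.sum_nonneg fun j _ => add_nonneg (hKp0 j) (hKn0 j)
  refine ⟨L * C + ∑ j, (Kp j + Kn j), by positivity, ?_, ?_⟩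
  · intro t ht s hs x hx
    by_cases hxK : totalMass m x ≤ K
    · have hxm : x ∈ massSublevel m K := ⟨hx, hxK⟩
      have hball : ∀ t ∈ Icc 0 T, (x, charGradient X P t x) ∈
          Metric.closedBall (0 : Conc N × Conc N) (max r C) := fun t ht => by
        rw [mem_closedBall_zero_iff, Prod.norm_mk]
        exact max_le_max (hr x hxm) (hq t ht x hxm)
      have h1 := hHlip _ (hball t ht) _ (hball s hs)
      have h2 := hlip t ht s hs x hxm x hxm
      rw [sub_self, norm_zero, add_zero] at h2
      rw [Prod.mk_sub_mk, sub_self, Prod.norm_mk, norm_zero, max_eq_right (norm_nonneg _)] at h1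
      calc _ ≤ L * (C * |t - s|) := h1.trans (by gcongr)
        _ ≤ _ := by nlinarith [mul_nonneg hS (abs_nonneg (t - s))]
    · push Not at hxK
      rw [(hconst t ht x hx hxK).2, (hconst s hs x hx hxK).2, sub_self, abs_zero]
      positivity
  · intro t ht h hh i hi
    set x := gridPoint h i with hxdef
    have hx : x ∈ orthant N := (gridPoint_mem_orthant_iff hh).2 hi
    set w : (Fin N → ℤ) → ℝ := fun k => R.extendedSolution u0 X P t (gridPoint h k) with hw
    have hwi : ∀ k, (∀ l, 0 ≤ k l) → w k = R.charSolution u0 X P t (gridPoint h k) :=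
      fun k hk => extendedSolution_of_mem ((gridPoint_mem_orthant_iff hh).2 hk)
    have hmassp : ∀ j, totalMass m (gridPoint h (i + R.nu j)) = totalMass m x := fun j => by
      rw [hxdef, totalMass_gridPoint, totalMass_gridPoint, sum_add_nu hm]
    have hmassn : ∀ j, totalMass m (gridPoint h (i - R.nu j)) = totalMass m x := fun j => by
      rw [hxdef, totalMass_gridPoint, totalMass_gridPoint, sum_sub_nu hm]
    by_cases hxK : totalMass m x ≤ K
    · have hxm : x ∈ massSublevel m K := ⟨hx, hxK⟩
      set q := charGradient X P t x with hqdef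
      have hQ : ∀ v : Conc N, |inner ℝ q v| ≤ C * ‖v‖ + C * (2 * r) * ‖v‖ := fun v =>
        (abs_real_inner_le_norm q v).trans (by
          have := mul_le_mul_of_nonneg_right (hq t ht x hxm) (norm_nonneg v)
          linarith [show 0 ≤ C * (2 * r) * ‖v‖ by positivity])
      have hE : ∀ (k : Fin N → ℤ) (v : Conc N), gridPoint h k = x + h • v →
          totalMass m (gridPoint h k) = totalMass m x → (∀ l, 0 ≤ k l) →
          |(w k - w i) / h| ≤ C * ‖v‖ + C * (2 * r) * ‖v‖ ∧
          |(w k - w i) / h - inner ℝ q v| ≤ C * ‖v‖ ^ 2 * h := by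
        intro k v hk hmk hk0
        have hkm : x + h • v ∈ massSublevel m K := by
          rw [← hk]
          exact ⟨(gridPoint_mem_orthant_iff hh).2 hk0, hmk.trans_le hxK⟩
        rw [hwi k hk0, hwi i hi, hk]
        exact abs_difference_quotient_le hh hC (hq t ht x hxm) (hr x hxm) (hr _ hkm)
          (htay t ht x hxm _ hkm)
      have hplus : ∀ j, |(if ∀ l, 0 ≤ (i + R.nu j) l then
            mesoMassAction (R.kPlus j) (R.nuPlus j) h i
              * (Real.exp ((w (i + R.nu j) - w i) / h) - 1) else 0)
          - massPoly (R.kPlus j) (R.nuPlus j) x * (Real.exp (R.nuDot j q) - 1)| ≤ Kp j * h := by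
        intro j
        obtain ⟨h1, h2⟩ := hp j h hh i hi (hr x hxm)
        refine abs_reaction_term_sub_le (b := R.nuMinus j) (fun l => ?_) hh
          (mesoMassAction_nonneg (R.kPlus_nonneg j) _ hh i) h1 (hCe0 j) h2 ?_ (fun hpos => ?_)
        · simp only [Pi.add_apply, nu]; ring
        · rw [← inner_nuVec]; exact hQ _
        · rw [← inner_nuVec]
          exact hE _ _ (R.gridPoint_add_nu h i j) (hmassp j) hpos
      have hminus : ∀ j, |(if ∀ l, 0 ≤ (i - R.nu j) l then
            mesoMassAction (R.kMinus j) (R.nuMinus j) h i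
              * (Real.exp ((w (i - R.nu j) - w i) / h) - 1) else 0)
          - massPoly (R.kMinus j) (R.nuMinus j) x * (Real.exp (-R.nuDot j q) - 1)|
          ≤ Kn j * h := by
        intro j
        obtain ⟨h1, h2⟩ := hn j h hh i hi (hr x hxm)
        refine abs_reaction_term_sub_le (b := R.nuPlus j) (fun l => ?_) hh
          (mesoMassAction_nonneg (R.kMinus_nonneg j) _ hh i) h1 (hCe0 j) h2 ?_ (fun hpos => ?_)
        · simp only [Pi.sub_apply, nu]; ring
        · rw [← inner_nuVec, ← inner_neg_right]
          simpa only [norm_neg] using hQ (-R.nuVec j)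
        · rw [← inner_nuVec, ← inner_neg_right]
          simpa only [norm_neg] using
            hE _ _ (R.gridPoint_sub_nu h i j) (hmassn j) hpos
      have hsum : |R.discreteHamiltonian h w i - R.smoothHamiltonian (x, q)|
          ≤ ∑ j, (Kp j * h + Kn j * h) := by
        rw [discreteHamiltonian, smoothHamiltonian, ← Finset.sum_add_distrib,
          ← Finset.sum_sub_distrib]
        refine (Finset.abs_sum_le_sum_abs _ _).trans (Finset.sum_le_sum fun j _ => ?_)
        rw [add_sub_add_comm]
        exact (abs_add_le _ _).trans (add_le_add (hplus j) (hminus j))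
      refine hsum.trans ?_
      simp only [← add_mul]
      rw [← Finset.sum_mul]
      gcongr
      linarith [mul_nonneg hL hC]
    · push Not at hxK
      have hwc : ∀ k, (∀ l, 0 ≤ k l) → totalMass m (gridPoint h k) = totalMass m x → w k = c := by
        intro k hk hmk
        rw [hwi k hk]
        exact (hconst t ht _ ((gridPoint_mem_orthant_iff hh).2 hk) (hmk ▸ hxK)).1
      -- Reactions do not leave the mass level, and above mass `K` the solution takes the single
      -- value `c`, so every exponent is zero.
      have hd : R.discreteHamiltonian h w i = 0 := by
        rw [discreteHamiltonian, Finset.sum_eq_zero, Finset.sum_eq_zero, add_zero]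
        · intro j _
          split_ifs with hpos
          · rw [hwc (i - R.nu j) hpos (hmassn j), hwc i hi rfl]
            simp
          · rfl
        · intro j _
          split_ifs with hpos
          · rw [hwc (i + R.nu j) hpos (hmassp j), hwc i hi rfl]
            simp
          · rfl
      rw [hd, (hconst t ht x hx hxK).2, R.smoothHamiltonian_zero_right, sub_self, abs_zero]
      positivity

end ReactionNetwork

/-! ### Frozen values off the orthant and backward differences -/

namespace ReactionNetwork

variable {N M : ℕ} {R : ReactionNetwork N M} {T h : ℝ}

theorem IsBackwardEulerSolution.eq_init_of_neg {dt : ℝ} (hdt : 0 < dt)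
    {w0 : (Fin N → ℤ) → ℝ} {w : ℕ → (Fin N → ℤ) → ℝ}
    (hw : R.IsBackwardEulerSolution T h dt w0 w) {i : Fin N → ℤ} (hi : ¬ ∀ l, 0 ≤ i l) :
    ∀ n : ℕ, (n : ℝ) * dt ≤ T → w n i = w0 i := by
  intro n
  induction n with
  | zero => intro _; rw [hw.1]
  | succ n ih =>
    intro hn
    have h1 := hw.2 n hn i
    rw [discreteHamiltonian_of_neg hi, sub_zero, div_eq_zero_iff, or_iff_left hdt.ne'] at h1
    rw [sub_eq_zero.1 h1]
    refine ih ?_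
    push_cast at hn
    linarith

theorem IsMonotoneSchemeSolution.eq_init_of_neg {w0 : (Fin N → ℤ) → ℝ}
    {w : ℝ → (Fin N → ℤ) → ℝ} (hw : R.IsMonotoneSchemeSolution T h w0 w) {i : Fin N → ℤ}
    (hi : ¬ ∀ l, 0 ≤ i l) {t : ℝ} (ht : t ∈ Icc 0 T) : w t i = w0 i := by
  rw [← hw.1]
  rcases ht.1.eq_or_lt with rfl | hpos
  · rfl
  obtain ⟨c, hc, hslope⟩ := exists_hasDerivAt_eq_slope (fun s => w s i)
    (fun s => R.discreteHamiltonian h (w s) i) hpos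
    ((hw.2 i).1.mono (Icc_subset_Icc_right ht.2))
    (fun s hs => (hw.2 i).2 s ⟨hs.1, hs.2.trans_le ht.2⟩)
  rw [discreteHamiltonian_of_neg hi, eq_comm, div_eq_zero_iff, sub_zero,
    or_iff_left hpos.ne'] at hslope
  exact sub_eq_zero.1 hslope

/-- A function whose derivative is Lipschitz is well approximated by backward differences. -/
theorem abs_backward_difference_le {f f' : ℝ → ℝ} {C s t : ℝ} (hC : 0 ≤ C) (hs : s ∈ Icc 0 T)
    (ht : t ∈ Icc 0 T) (hst : s ≤ t)
    (hf : ∀ τ ∈ Icc 0 T, HasDerivWithinAt f (f' τ) (Icc 0 T) τ)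
    (hf' : ∀ τ ∈ Icc 0 T, |f' t - f' τ| ≤ C * |t - τ|) :
    |f t - f s - (t - s) * f' t| ≤ (t - s) * (C * (t - s)) := by
  have hsub : Icc s t ⊆ Icc 0 T := Icc_subset_Icc hs.1 ht.2
  -- Mean value inequality after subtracting the linear function with the slope at the later time
  -- `t`, which is the slope used by backward Euler.
  have key := (convex_Icc s t).norm_image_sub_le_of_norm_hasDerivWithin_le
    (f := fun τ => f τ - τ * f' t) (f' := fun τ => f' τ - 1 * f' t) (C := C * (t - s))
    (fun τ hτ => ((hf τ (hsub hτ)).mono hsub).sub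
      ((hasDerivWithinAt_id τ (Icc s t)).mul_const (f' t)))
    (fun τ hτ => by
      rw [one_mul, Real.norm_eq_abs, abs_sub_comm]
      refine (hf' τ (hsub hτ)).trans ?_
      gcongr
      rw [abs_of_nonneg (by linarith [hτ.2])]
      linarith [hτ.1]) ⟨le_rfl, hst⟩ ⟨hst, le_rfl⟩
  rw [Real.norm_eq_abs, Real.norm_eq_abs, abs_of_nonneg (sub_nonneg.2 hst)] at key
  rw [mul_comm (t - s) (C * (t - s))]
  convert key using 2
  ring

end ReactionNetwork

end ChemHJE

end

/-! ### The main theorem -/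

theorem mainTheorem10 {N M : ℕ} (R : ChemHJE.ReactionNetwork N M)
    (hmass : R.ConservesMass) (hLip : R.LocallyLipschitzRates)
    (u0 : ChemHJE.Conc N → ℝ) (hu0 : ContDiff ℝ 2 u0) (hu0c : ChemHJE.ConstAtInfinity u0)
    (T : ℝ) (hT : 0 < T) (hbi : R.BicharacteristicsExistUniquely u0 T) :
    ∃ u : ℝ → ChemHJE.Conc N → ℝ,
      R.IsClassicalSolution u0 T u ∧
      (∀ v : ℝ → ChemHJE.Conc N → ℝ, R.IsClassicalSolution u0 T v →
        ∀ t ∈ Set.Icc 0 T, ∀ x, v t x = u t x) ∧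
      ∀ C₀ : ℝ, ∃ C : ℝ, 0 < C ∧
        ∀ h : ℝ, 0 < h → ∀ uh0 : (Fin N → ℤ) → ℝ,
          (∀ i, |uh0 i - u0 (ChemHJE.gridPoint h i)| ≤ C₀ * h) →
          (∀ dt : ℝ, 0 < dt → ∀ uh : ℕ → (Fin N → ℤ) → ℝ,
            R.IsBackwardEulerSolution T h dt uh0 uh →
            ∀ n : ℕ, (n : ℝ) * dt ≤ T → ∀ i,
              |uh n i - u ((n : ℝ) * dt) (ChemHJE.gridPoint h i)| ≤ C * (T + 1) * (dt + h)) ∧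
          (∀ uh : ℝ → (Fin N → ℤ) → ℝ,
            R.IsMonotoneSchemeSolution T h uh0 uh →
            ∀ t : ℝ, 0 < t → t ≤ T → ∀ i,
              |uh t i - u t (ChemHJE.gridPoint h i)| ≤ C * h) := by
  obtain ⟨X, P, hf, hbi⟩ := hbi
  obtain ⟨m, hmpos, hm⟩ := id hmass
  set u := R.extendedSolution u0 X P with hudef
  have hu : R.IsClassicalSolution u0 T u := hf.isClassicalSolution hu0 hT hbi hmpos hm hLip
  refine ⟨u, hu, fun v hv t ht x => hv.eq_of_isClassicalSolution hmass hLip hT hu ht x,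
    fun C₀ => ?_⟩
  obtain ⟨C, hC, htime, hspace⟩ := hf.exists_consistency_bound hu0 hu0c hT hbi hmpos hm
  set D : ℝ → ChemHJE.Conc N → ℝ := fun t x =>
    R.smoothHamiltonian (x, ChemHJE.ReactionNetwork.charGradient X P t x) with hD
  have hderiv : ∀ t ∈ Set.Icc 0 T, ∀ x ∈ ChemHJE.orthant N,
      HasDerivWithinAt (fun s => u s x) (D t x) (Set.Icc 0 T) t := by
    intro t ht x hx
    simp only [hudef, ChemHJE.ReactionNetwork.extendedSolution_of_mem hx]
    exact hf.hasDeriv_charSolution hu0 hbi hmpos hm ht hx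
  -- `|C₀|` covers the initial error and `C * T` the consistency error accumulated up to time `T`;
  -- the rest is slack, and 1 ensures positivity.
  refine ⟨|C₀| + C + C * T + 1, by positivity, fun h hh uh0 huh0 => ⟨?_, ?_⟩⟩
  · intro dt hdt uh huh n hn i
    have hn0 : 0 ≤ (n : ℝ) * dt := by positivity
    have hC₀h : C₀ * h ≤ |C₀| * (dt + h) := by
      calc C₀ * h ≤ |C₀| * h := by gcongr; exact le_abs_self _
        _ ≤ _ := by gcongr; linarith
    have hfin : C₀ * h + n * dt * (C * dt + C * h)
        ≤ (|C₀| + C + C * T + 1) * (T + 1) * (dt + h) := by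
      have h1 : n * dt * (C * dt + C * h) ≤ T * (C * dt + C * h) := by gcongr
      have h2 : 0 ≤ |C₀| * T * (dt + h) := by positivity
      have h3 : 0 ≤ (C + (C * T + 1) * (T + 1)) * (dt + h) := by positivity
      nlinarith
    by_cases hi : ∀ l, 0 ≤ i l
    · have hbd : ∀ k : ℕ, ((k + 1 : ℕ) : ℝ) * dt ≤ T → ∀ i : Fin N → ℤ, (∀ l, 0 ≤ i l) →
          |u (((k + 1 : ℕ) : ℝ) * dt) (ChemHJE.gridPoint h i)
            - u ((k : ℝ) * dt) (ChemHJE.gridPoint h i)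
            - dt * D (((k + 1 : ℕ) : ℝ) * dt) (ChemHJE.gridPoint h i)| ≤ dt * (C * dt) ∧
          |R.discreteHamiltonian h
              (fun k' => u (((k + 1 : ℕ) : ℝ) * dt) (ChemHJE.gridPoint h k')) i
            - D (((k + 1 : ℕ) : ℝ) * dt) (ChemHJE.gridPoint h i)| ≤ C * h := by
        intro k hk i hi
        have hx := (ChemHJE.gridPoint_mem_orthant_iff hh).2 hi
        have e : ((k + 1 : ℕ) : ℝ) * dt - k * dt = dt := by push_cast; ring
        have hk1 : ((k + 1 : ℕ) : ℝ) * dt ∈ Set.Icc 0 T := ⟨by positivity, hk⟩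
        have hk0 : (k : ℝ) * dt ∈ Set.Icc 0 T := ⟨by positivity, by linarith⟩
        have h1 := ChemHJE.ReactionNetwork.abs_backward_difference_le hC hk0 hk1 (by linarith)
          (fun τ hτ => hderiv τ hτ _ hx) (fun τ hτ => htime _ hk1 τ hτ _ hx)
        rw [e] at h1
        exact ⟨h1, hspace _ hk1 h hh i hi⟩
      have hstep : ∀ k : ℕ, ((k + 1 : ℕ) : ℝ) * dt ≤ T → ∀ i : Fin N → ℤ,
          uh (k + 1) i - uh k i = dt * R.discreteHamiltonian h (uh (k + 1)) i := by
        intro k hk i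
        have := sub_eq_zero.1 (huh.2 k hk i)
        rw [← this]
        field_simp
      -- The exact solution satisfies the scheme up to `C * dt + C * h` on either side, so it serves
      -- first as a supersolution and then as a subsolution.
      have hup := ChemHJE.ReactionNetwork.backwardEuler_comparison (R := R) (T := T) hmpos hm hh
        hdt (ε := C₀ * h) (δ₁ := 0) (δ₂ := C * dt + C * h) (w := uh)
        (v := fun k i => u ((k : ℝ) * dt) (ChemHJE.gridPoint h i))
        (fun i => by
          have := (abs_le.1 (huh0 i)).2
          simp only [huh.1, Nat.cast_zero, zero_mul, hu.init]
          linarith)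
        (fun k hk i _ => by rw [hstep k hk i, add_zero])
        (fun k hk i hi => by
          obtain ⟨h1, h2⟩ := hbd k hk i hi
          have h3 := mul_le_mul_of_nonneg_left (abs_le.1 h2).2 hdt.le
          have h4 := (abs_le.1 h1).1
          nlinarith) n hn i hi
      have hlow := ChemHJE.ReactionNetwork.backwardEuler_comparison (R := R) (T := T) hmpos hm hh
        hdt (ε := C₀ * h) (δ₁ := C * dt + C * h) (δ₂ := 0) (v := uh)
        (w := fun k i => u ((k : ℝ) * dt) (ChemHJE.gridPoint h i))
        (fun i => by
          have := (abs_le.1 (huh0 i)).1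
          simp only [huh.1, Nat.cast_zero, zero_mul, hu.init]
          linarith)
        (fun k hk i hi => by
          obtain ⟨h1, h2⟩ := hbd k hk i hi
          have h3 := mul_le_mul_of_nonneg_left (abs_le.1 h2).1 hdt.le
          have h4 := (abs_le.1 h1).2
          nlinarith)
        (fun k hk i _ => by rw [hstep k hk i, sub_zero]) n hn i hi
      rw [zero_add] at hup
      rw [add_zero] at hlow
      rw [abs_le]
      constructor <;> linarith
    -- Off the orthant both the scheme and the solution are frozen, so only the initial error is
    -- left.
    · have hx : ChemHJE.gridPoint h i ∉ ChemHJE.orthant N := fun hx =>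
        hi ((ChemHJE.gridPoint_mem_orthant_iff hh).1 hx)
      rw [huh.eq_init_of_neg hdt hi n hn, hu.eq_init_of_notMem ⟨hn0, hn⟩ hx]
      refine (huh0 i).trans (le_trans ?_ hfin)
      have : 0 ≤ n * dt * (C * dt + C * h) := by positivity
      linarith
  · intro uh huh t ht0 htT i
    have ht : t ∈ Set.Icc 0 T := ⟨ht0.le, htT⟩
    have hfin : C₀ * h + t * (C * h) ≤ (|C₀| + C + C * T + 1) * h := by
      have h1 : C₀ * h ≤ |C₀| * h := by gcongr; exact le_abs_self _
      have h2 : t * (C * h) ≤ T * (C * h) := by gcongr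
      have h3 : 0 ≤ (C + 1) * h := by positivity
      nlinarith
    by_cases hi : ∀ l, 0 ≤ i l
    · have hIcc : ∀ s ∈ Set.Ioo 0 T, s ∈ Set.Icc 0 T := fun s hs => ⟨hs.1.le, hs.2.le⟩
      have hcu : ∀ i : Fin N → ℤ, (∀ l, 0 ≤ i l) →
          ContinuousOn (fun t => u t (ChemHJE.gridPoint h i)) (Set.Icc 0 T) := fun i hi s hs =>
        (hderiv s hs _ ((ChemHJE.gridPoint_mem_orthant_iff hh).2 hi)).continuousWithinAt
      have hdu : ∀ i : Fin N → ℤ, (∀ l, 0 ≤ i l) → ∀ s ∈ Set.Ioo 0 T,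
          HasDerivAt (fun t => u t (ChemHJE.gridPoint h i)) (D s (ChemHJE.gridPoint h i)) s :=
        fun i hi s hs => (hderiv s (hIcc s hs) _
          ((ChemHJE.gridPoint_mem_orthant_iff hh).2 hi)).hasDerivAt (Icc_mem_nhds hs.1 hs.2)
      have hup := ChemHJE.ReactionNetwork.monotoneScheme_comparison (R := R) (T := T) hmpos hm hh
        (ε := C₀ * h) (δ₁ := 0) (δ₂ := C * h) (w := uh)
        (v := fun t i => u t (ChemHJE.gridPoint h i))
        (w' := fun t i => R.discreteHamiltonian h (uh t) i)
        (v' := fun t i => D t (ChemHJE.gridPoint h i))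
        (fun i => by
          have := (abs_le.1 (huh0 i)).2
          simp only [huh.1, hu.init]
          linarith)
        (fun i _ => (huh.2 i).1) hcu (fun i _ => (huh.2 i).2) hdu
        (fun i _ s _ => by simp)
        (fun i hi s hs => by
          have := (abs_le.1 (hspace s (hIcc s hs) h hh i hi)).2
          simp only [hD]
          linarith) ht hi hT
      have hlow := ChemHJE.ReactionNetwork.monotoneScheme_comparison (R := R) (T := T) hmpos hm hh
        (ε := C₀ * h) (δ₁ := C * h) (δ₂ := 0) (v := uh)
        (w := fun t i => u t (ChemHJE.gridPoint h i))
        (v' := fun t i => R.discreteHamiltonian h (uh t) i)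
        (w' := fun t i => D t (ChemHJE.gridPoint h i))
        (fun i => by
          have := (abs_le.1 (huh0 i)).1
          simp only [huh.1, hu.init]
          linarith)
        hcu (fun i _ => (huh.2 i).1) hdu (fun i _ => (huh.2 i).2)
        (fun i hi s hs => by
          have := (abs_le.1 (hspace s (hIcc s hs) h hh i hi)).1
          simp only [hD]
          linarith)
        (fun i _ s _ => by simp) ht hi hT
      rw [zero_add] at hup
      rw [add_zero] at hlow
      rw [abs_le]
      constructor <;> linarith
    · have hx : ChemHJE.gridPoint h i ∉ ChemHJE.orthant N := fun hx =>
        hi ((ChemHJE.gridPoint_mem_orthant_iff hh).1 hx)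
      rw [huh.eq_init_of_neg hi ht, hu.eq_init_of_notMem ht hx]
      refine (huh0 i).trans (le_trans ?_ hfin)
      have : 0 ≤ t * (C * h) := by positivity
      linarith
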